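/- **Setting.** Let $L>1$ be an odd integer and $n\ge 1$. Put $\Omega=\{0,\dots,n-1\}^2$, let $\Omega'$ be the set of oriented bonds $b=(b_-,b_+)=(x,x+e_\mu)$ with both ends in $\Omega$, and let $\Omega_1=(L\mathbb Z)^2\cap\Omega$, with oriented bonds $(y,y+Le_\mu)$ having both ends in $\Omega_1$. For $y\in\Omega_1$ let $B_1(y)=\{x\in\Omega: y_\mu\le x_\mu<y_\mu+L,\ \mu=0,1\}$, and let $y_x$ be the label of the box containing $x$. Fields on $\Omega$, $\Omega_1$, $\Omega'$ take values in $\mathbb R^3$; $|\cdot|$ is the Euclidean norm, and $\|A\|_\infty=\sup_{x\in\Omega}|A(x)|$. Define $$(\partial f)(b)=f(b_-)-f(b_+),\qquad (Qf)(y)=L^{-2}\sum_{x\in B_1(y)}f(x),\qquad (Q^*f)(x)=f(y_x),$$ let $\partial^*$ be the adjoint of $\partial$ (for the unweighted $\ell^2$ scalar products on $\Omega$ and $\Omega'$), $-\Delta_\Omega=\partial^*\partial$, and $G(\Omega)=(-\Delta_\Omega+Q^*Q)^{-1}$. For $v\in\mathbb R^3$ with $|v|\le 1$ put $[v]=\sqrt{1-|v|^2}\,1+i\,v\cdot\sigma\in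 SU(2)$, where $\sigma$ is the vector of Pauli matrices; on $2\times2$ matrices $\|\cdot\|$ is the operator norm. Let $V:\Omega_1\to SU(2)$. For a field $A$ on $\Omega$ with $|A(x)|\le 1$ for all $x$, and with $A_0=\sqrt{1-|A|^2}$, put $$W_A(b)=[A(b_-)]\,V(y_{b_-})V(y_{b_+})^*\,[A(b_+)]^*,\qquad r_A(b)=\vec W_A(b)-(\partial A)(b),$$ where $\vec W_A(b)\in\mathbb R^3$ is defined by $W_A(b)=w_0\,1+i\,\vec W_A(b)\cdot\sigma$ with $w_0\in\mathbb R$, and $$(R_A^*v)(x)=A_0(x)v(x)-A(x)\times v(x),\qquad M_A=G(\Omega)R_A^*Q^*[QG(\Omega)R_A^*Q^*]^{-1}Q,$$ $$T(A)=(M_A-1)\,G(\Omega)\,\partial^*r_A .$$ For a constant $c\ge 1$ and $\varepsilon>0$ let $$X_\varepsilon=\Big\{A:\ |A(x)|\le 4cL^2\varepsilon\ (x\in\Omega),\quad QA=0,\quad \|W_A(b)-1\|\le\varepsilon\ (b\in\Omega')\Big\}.$$ (The last condition is the small-field condition $\|U(b_-)U(b_+)^*-1\|\le\varepsilon$ for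 the configuration $U(x)=[A(x)]V(y_x)$.) **Theorem.** Let $L>1$ be odd and $c\ge1$. There are $\varepsilon_0\in(0,1]$ and $q\in[0,1)$, depending only on $L$ and $c$, such that for all $\varepsilon\in(0,\varepsilon_0]$, all $\varepsilon_1\in(0,\varepsilon^2]$, all $n\ge1$ and all $V:\Omega_1\to SU(2)$ with $\|V(b_-)V(b_+)^*-1\|\le\varepsilon_1$ for every oriented bond $b$ of $\Omega_1$: 1. $-\Delta_\Omega+Q^*Q$ is invertible, and $QG(\Omega)R_A^*Q^*$ is invertible for every $A\in X_\varepsilon$, so that $T$ is well defined on $X_\varepsilon$; 2. $T$ maps $X_\varepsilon$ into itself; 3. $\|T(A_1)-T(A_2)\|_\infty\le q\,\|A_1-A_2\|_\infty$ for all $A_1,A_2\in X_\varepsilon$; 4. there is exactly one $A\in X_\varepsilon$ that solves the critical-point equation $$A=G(\Omega)R_A^*Q^*[QG(\Omega)R_A^*Q^*]^{-1}QG(\Omega)\partial^*r_A-G(\Omega)\partial^*r_A .$$ -/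

import Mathlib

namespace SigmaModel

open scoped BigOperators Matrix

noncomputable section

/-! ### The lattices -/

/-- The fine lattice `Ω = {0, …, n-1}²`. -/
abbrev Site (n : ℕ) : Type := Fin 2 → Fin n

/-- The coarse lattice `Ω₁ = (LΩ) ∩ Ω`: the sites all of whose coordinates are multiples of `L`. -/
abbrev CSite (n L : ℕ) : Type := {y : Site n // ∀ μ, L ∣ (y μ : ℕ)}

/-- The oriented bonds of `Ω`: the pairs `(b₋, b₊) = (x, x + e_μ)` with both ends in `Ω`. -/
abbrev Bond (n : ℕ) : Type :=
  {b : Site n × Site n //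
    ∃ μ : Fin 2, (b.2 μ : ℕ) = (b.1 μ : ℕ) + 1 ∧ ∀ ν, ν ≠ μ → b.2 ν = b.1 ν}

/-- The oriented bonds of `Ω₁`: the pairs `(y, y + L e_μ)` with both ends in `Ω₁`. -/
abbrev CBond (n L : ℕ) : Type :=
  {b : CSite n L × CSite n L //
    ∃ μ : Fin 2, (b.2.1 μ : ℕ) = (b.1.1 μ : ℕ) + L ∧ ∀ ν, ν ≠ μ → b.2.1 ν = b.1.1 ν}

/-- The box `B₁(y) = {x ∈ Ω | y_μ ≤ x_μ < y_μ + L}`. -/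
def box (n L : ℕ) (y : CSite n L) : Finset (Site n) :=
  Finset.univ.filter fun x => ∀ μ, (y.1 μ : ℕ) ≤ (x μ : ℕ) ∧ (x μ : ℕ) < (y.1 μ : ℕ) + L

/-- The label `y_x` of the box containing `x`, with coordinates `L ⌊x_μ / L⌋`. -/
def label (n L : ℕ) (x : Site n) : CSite n L :=
  ⟨fun μ => ⟨L * ((x μ : ℕ) / L), lt_of_le_of_lt (Nat.mul_div_le _ _) (x μ).isLt⟩,
    fun _ => Dvd.intro _ rfl⟩

/-- `y_x` is the unique label of a box containing `x`. -/
theorem mem_box_iff (n L : ℕ) (hL : 0 < L) (x : Site n) (y : CSite n L) :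
    x ∈ box n L y ↔ y = label n L x := by
  constructor
  · intro h
    have h' := (Finset.mem_filter.1 h).2
    apply Subtype.ext
    funext μ
    apply Fin.ext
    obtain ⟨k, hk⟩ := y.2 μ
    obtain ⟨h1, h2⟩ := h' μ
    change (y.1 μ : ℕ) = L * ((x μ : ℕ) / L)
    rw [hk] at h1 h2 ⊢
    congr 1
    symm
    apply Nat.div_eq_of_lt_le
    · rw [mul_comm]; exact h1
    · rw [Nat.succ_mul, mul_comm]; exact h2
  · rintro rfl
    refine Finset.mem_filter.2 ⟨Finset.mem_univ _, fun μ => ⟨Nat.mul_div_le _ _, ?_⟩⟩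
    exact Nat.lt_mul_div_succ _ hL

/-! ### `SU(2)` and Pauli matrices -/

/-- `ℝ³` with the Euclidean norm. -/
abbrev Vec : Type := EuclideanSpace ℝ (Fin 3)

abbrev Mat2 : Type := Matrix (Fin 2) (Fin 2) ℂ

abbrev SU2 : Type := Matrix.specialUnitaryGroup (Fin 2) ℂ

/-- The operator norm of a `2 × 2` matrix acting on `ℂ²` with its Hermitian norm. -/
def opNorm (M : Mat2) : ℝ := ‖Matrix.toEuclideanCLM (n := Fin 2) (𝕜 := ℂ) M‖

/-- The Pauli matrices. -/
def pauli : Fin 3 → Mat2 :=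
  ![!![0, 1; 1, 0], !![0, -Complex.I; Complex.I, 0], !![1, 0; 0, -1]]

/-- The matrix `a 1 + i v · σ`. -/
def quat (a : ℝ) (v : Vec) : Mat2 :=
  (a : ℂ) • (1 : Mat2) + Complex.I • ∑ k, ((v k : ℝ) : ℂ) • pauli k

/-- The vector `w` in the decomposition `M = a 1 + i w · σ`. -/
def pauliVec (M : Mat2) : Vec :=
  WithLp.toLp 2 fun k => (Matrix.trace (M * pauli k)).im / 2

theorem pauliVec_quat (a : ℝ) (v : Vec) : pauliVec (quat a v) = v := by
  ext k
  fin_cases k <;>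
    simp [pauliVec, quat, pauli, Fin.sum_univ_three, Matrix.trace, Matrix.mul_apply]

/-- `A₀ = √(1 - |A|²)`. -/
def zeroPart (v : Vec) : ℝ := Real.sqrt (1 - ‖v‖ ^ 2)

/-- The bracket `[A] = A₀ 1 + i A · σ`, i.e. the matrix with vector part `A` and sign `s = 1`. -/
def bracket (v : Vec) : Mat2 := quat (zeroPart v) v

theorem bracket_mem_SU2 (v : Vec) (hv : ‖v‖ ≤ 1) :
    bracket v ∈ Matrix.specialUnitaryGroup (Fin 2) ℂ := by
  have h0 : zeroPart v * zeroPart v = 1 - (v 0 ^ 2 + v 1 ^ 2 + v 2 ^ 2) := by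
    have h1 : ‖v‖ ^ 2 = v 0 ^ 2 + v 1 ^ 2 + v 2 ^ 2 := by
      rw [EuclideanSpace.norm_sq_eq]; simp [Fin.sum_univ_three]
    rw [zeroPart, Real.mul_self_sqrt (by nlinarith [norm_nonneg v]), h1]
  have h0' : (zeroPart v : ℂ) * zeroPart v
      = 1 - ((v 0 : ℂ) ^ 2 + (v 1 : ℂ) ^ 2 + (v 2 : ℂ) ^ 2) := by exact_mod_cast h0
  rw [Matrix.mem_specialUnitaryGroup_iff, Matrix.mem_unitaryGroup_iff]
  constructor
  · ext i j
    fin_cases i <;> fin_cases j <;>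
      simp [bracket, quat, pauli, Fin.sum_univ_three, Matrix.mul_apply, Matrix.star_apply] <;>
      ring_nf <;> simp only [Complex.I_sq, Complex.I_pow_four] <;> linear_combination h0'
  · simp [bracket, quat, pauli, Fin.sum_univ_three, Matrix.det_fin_two]
    ring_nf
    simp only [Complex.I_sq, Complex.I_pow_four]
    linear_combination h0'

/-- The cross product on `ℝ³`. -/
def cross (v w : Vec) : Vec := WithLp.toLp 2 (crossProduct (WithLp.ofLp v) (WithLp.ofLp w))

/-! ### Linear operators on `ℝ³`-valued fields

Fields carry the sup norm `‖A‖ = sup_x |A(x)|` with `|·|` the Euclidean norm. -/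

abbrev VField (n : ℕ) : Type := Site n → Vec

abbrev CField (n L : ℕ) : Type := CSite n L → Vec

abbrev BField (n : ℕ) : Type := Bond n → Vec

/-- `(∂f)(b) = f(b₋) - f(b₊)`. -/
def grad (n : ℕ) : VField n →ₗ[ℝ] BField n where
  toFun f b := f b.1.1 - f b.1.2
  map_add' f g := by funext b; simp only [Pi.add_apply]; abel
  map_smul' a f := by funext b; simp [smul_sub]

/-- `∂*`, the adjoint of `∂` (see `inner_grad`). -/
def gradAdj (n : ℕ) : BField n →ₗ[ℝ] VField n where
  toFun g x := ∑ b : Bond n, ((if b.1.1 = x then g b else 0) - (if b.1.2 = x then g b else 0))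
  map_add' f g := by
    funext x
    simp only [Pi.add_apply, ← Finset.sum_add_distrib]
    refine Finset.sum_congr rfl fun b _ => ?_
    split_ifs <;> simp; abel
  map_smul' a f := by
    funext x
    simp only [Pi.smul_apply, RingHom.id_apply, Finset.smul_sum, smul_sub, smul_ite, smul_zero]

theorem inner_grad (n : ℕ) (f : VField n) (g : BField n) :
    ∑ b, inner ℝ (grad n f b) (g b) = ∑ x, inner ℝ (f x) (gradAdj n g x) := by
  simp only [grad, gradAdj, LinearMap.coe_mk, AddHom.coe_mk, inner_sum, inner_sub_left,
    inner_sub_right]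
  rw [Finset.sum_comm]
  refine Finset.sum_congr rfl fun b _ => ?_
  rw [Finset.sum_sub_distrib]
  congr 1
  · rw [Finset.sum_eq_single b.1.1] <;> simp +contextual [eq_comm]
  · rw [Finset.sum_eq_single b.1.2] <;> simp +contextual [eq_comm]

/-- The block average `(Qf)(y) = L⁻² ∑_{x ∈ B₁(y)} f(x)`. -/
def avg (n L : ℕ) : VField n →ₗ[ℝ] CField n L where
  toFun f y := ((L : ℝ) ^ 2)⁻¹ • ∑ x ∈ box n L y, f x
  map_add' f g := by funext y; simp [Finset.sum_add_distrib]
  map_smul' a f := by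
    funext y
    simp only [Pi.smul_apply, RingHom.id_apply, ← Finset.smul_sum]
    rw [smul_comm]

/-- `(Q*f)(x) = f(y_x)`, the adjoint of `Q` (see `inner_avg`). -/
def avgAdj (n L : ℕ) : CField n L →ₗ[ℝ] VField n where
  toFun f x := f (label n L x)
  map_add' _ _ := rfl
  map_smul' _ _ := rfl

/-- `⟨Qf, g⟩_{Ω₁} = ⟨f, Q*g⟩_Ω`, where the scalar product on `Ω₁` carries the weight `L²`. -/
theorem inner_avg (n L : ℕ) (hL : 0 < L) (f : VField n) (g : CField n L) :
    (L : ℝ) ^ 2 * ∑ y, inner ℝ (avg n L f y) (g y) = ∑ x, inner ℝ (f x) (avgAdj n L g x) := by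
  have hL' : (L : ℝ) ^ 2 ≠ 0 := by positivity
  simp only [avg, avgAdj, LinearMap.coe_mk, AddHom.coe_mk, real_inner_smul_left, sum_inner,
    ← Finset.mul_sum]
  rw [mul_inv_cancel_left₀ hL']
  have h : ∀ y : CSite n L, ∑ x ∈ box n L y, inner ℝ (f x) (g y)
      = ∑ x, if y = label n L x then inner ℝ (f x) (g y) else 0 := by
    intro y
    rw [← Finset.sum_filter]
    refine Finset.sum_congr ?_ fun _ _ => rfl
    ext x
    simp [mem_box_iff n L hL]
  simp only [h]
  rw [Finset.sum_comm]
  simp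

/-- `-Δ_Ω + Q*Q`, where `-Δ_Ω = ∂*∂` is the Neumann Laplacian. -/
def hamiltonian (n L : ℕ) : Module.End ℝ (VField n) :=
  gradAdj n ∘ₗ grad n + avgAdj n L ∘ₗ avg n L

/-- The Green function `G(Ω) = (-Δ_Ω + Q*Q)⁻¹`. -/
def green (n L : ℕ) : Module.End ℝ (VField n) := Ring.inverse (hamiltonian n L)

/-- `(R*_A v)(x) = A₀(x) v(x) - A(x) × v(x)`, the adjoint of
`(R_A v)(x) = A₀(x) v(x) + A(x) × v(x)` (see `inner_rot`). -/
def rotAdj {n : ℕ} (A : VField n) : Module.End ℝ (VField n) where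
  toFun v x := zeroPart (A x) • v x - cross (A x) (v x)
  map_add' v w := by
    funext x
    simp only [cross, Pi.add_apply, smul_add, WithLp.ofLp_add, map_add, WithLp.toLp_add]
    abel
  map_smul' a v := by
    funext x
    simp only [cross, Pi.smul_apply, WithLp.ofLp_smul, map_smul, WithLp.toLp_smul,
      RingHom.id_apply, smul_sub]
    rw [smul_comm]

theorem inner_rot {n : ℕ} (A v w : VField n) (x : Site n) :
    inner ℝ (zeroPart (A x) • w x + cross (A x) (w x)) (v x) = inner ℝ (w x) (rotAdj A v x) := by
  simp only [rotAdj, cross, LinearMap.coe_mk, AddHom.coe_mk, PiLp.inner_apply,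
    Fin.sum_univ_three, cross_apply]
  simp
  ring

/-- The operator `D_A = Q G(Ω) R*_A Q*` on coarse fields. -/
def coarseOp (n L : ℕ) (A : VField n) : Module.End ℝ (CField n L) :=
  avg n L ∘ₗ green n L ∘ₗ rotAdj A ∘ₗ avgAdj n L

/-- `M_A = G(Ω) R*_A Q* [Q G(Ω) R*_A Q*]⁻¹ Q`. -/
def projOp (n L : ℕ) (A : VField n) : Module.End ℝ (VField n) :=
  green n L ∘ₗ rotAdj A ∘ₗ avgAdj n L ∘ₗ Ring.inverse (coarseOp n L A) ∘ₗ avg n L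

/-! ### Configurations, the remainder and the fixed-point map -/

/-- The small field condition on `Ω₁`: `V ∈ Conf_{ε₁}(Ω₁)`. -/
def CoarseSmallField {n L : ℕ} (ε₁ : ℝ) (V : CSite n L → SU2) : Prop :=
  ∀ b : CBond n L, opNorm ((V b.1.1 : Mat2) * (V b.1.2 : Mat2)ᴴ - 1) ≤ ε₁

/-- `W(b) = [A](b₋) ∂V(y_b) [A](b₊)*` with `∂V(y_b) = V(y_{b₋}) V(y_{b₊})*`. This is
`∂U(b) = U(b₋) U(b₊)*` for the configuration `U(x) = [A(x)] V(y_x)`. -/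
def plaq {n L : ℕ} (V : CSite n L → SU2) (A : VField n) (b : Bond n) : Mat2 :=
  bracket (A b.1.1) * ((V (label n L b.1.1) : Mat2) * (V (label n L b.1.2) : Mat2)ᴴ) *
    (bracket (A b.1.2))ᴴ

/-- The remainder `r_A = W⃗ - ∂A`. -/
def remainder {n L : ℕ} (V : CSite n L → SU2) (A : VField n) : BField n :=
  fun b => pauliVec (plaq V A b) - grad n A b

/-- The space `X_ε`: `|A(x)| ≤ 4 c L² ε` for all `x`, `QA = 0`, and the small field condition
`‖∂U(b) - 1‖ ≤ ε` for all bonds `b`, where `U(x) = [A(x)] V(y_x)`. -/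
def fieldSpace {n L : ℕ} (c : ℝ) (V : CSite n L → SU2) (ε : ℝ) : Set (VField n) :=
  {A | (∀ x, ‖A x‖ ≤ 4 * c * (L : ℝ) ^ 2 * ε) ∧ avg n L A = 0 ∧
    ∀ b, opNorm (plaq V A b - 1) ≤ ε}

/-- `T(A) = (M_A - 1) G(Ω) ∂* r_A`. -/
def fixMap {n L : ℕ} (V : CSite n L → SU2) (A : VField n) : VField n :=
  (projOp n L A - 1) (green n L (gradAdj n (remainder V A)))

/-- The critical-point equation
`A = G(Ω) R*_A Q* [Q G(Ω) R*_A Q*]⁻¹ Q G(Ω) ∂* r_A - G(Ω) ∂* r_A`. -/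
def IsCriticalSolution {n L : ℕ} (V : CSite n L → SU2) (A : VField n) : Prop :=
  A = green n L (rotAdj A (avgAdj n L (Ring.inverse (coarseOp n L A)
        (avg n L (green n L (gradAdj n (remainder V A))))))) -
      green n L (gradAdj n (remainder V A))

end

end SigmaModel

namespace SigmaModel

open scoped BigOperators Matrix

/-! ### Combinatorics of the lattices -/

/-! `T` is a contraction in the sup norm because the remainder `r_A` is of second order, while the
linear operators in `T` are bounded on sup norms by constants that depend only on `L`.

Linear part. A Poincaré inequality on each box makes `-Δ + Q*Q` coercive in `ℓ²` (`poincare`).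
Coercivity survives conjugation by weights that vary slowly from box to box (`weighted_coercive`),
and with an upper bound for the same form it gives a lower bound for `QGQ*`
(`weighted_coarse_lower`). Exponentially decaying weights, equal to 1 at a chosen box and with
square sum bounded uniformly in `n`, turn the weighted `ℓ²` bounds into sup norm bounds
(`norm_le_of_weighted`). For `A ≠ 0`, `QGR_A*Q*` is a small perturbation of `QGQ*`
(`LinearBounds.norm_le_coarseOp`).

Nonlinear part. The linear terms of the vector part of `[A]·[A]*` are exactly `∂A`. What remains is
quadratic in `A`, plus a term of size `ε₁` from the coarse field (`remainder_eq`). On the ball of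
radius `4cL²ε` the remainder is therefore `O(ε²)`, as `ε₁ ≤ ε²`, with Lipschitz constant `O(ε)`.

Conclusion. On this ball `T` is a contraction with values of size `O(ε²)`. Since `Q M_A = Q`, these
values are averaged to zero, and they are small enough to satisfy the bond condition. So `T` maps
the ball into `X_ε`, which lies in the ball: the Banach fixed point of the ball is in `X_ε`, and
neither completeness nor nonemptiness of `X_ε` has to be shown separately. -/

theorem sum_comp_le_of_injective {ι κ : Type*} [Fintype ι] [Fintype κ] {e : ι → κ}
    (he : Function.Injective e) {g : κ → ℝ} (hg : ∀ k, 0 ≤ g k) :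
    ∑ i, g (e i) ≤ ∑ k, g k := by
  classical
  rw [← Finset.sum_image (s := Finset.univ) (g := e) (f := g) fun _ _ _ _ h => he h]
  exact Finset.sum_le_sum_of_subset_of_nonneg (Finset.subset_univ _) fun k _ _ => hg k

theorem card_box_le (n L : ℕ) (y : CSite n L) : (box n L y).card ≤ L ^ 2 := by
  have h : ∀ x ∈ box n L y, ∀ μ, (y.1 μ : ℕ) ≤ (x μ : ℕ) ∧ (x μ : ℕ) < (y.1 μ : ℕ) + L :=
    fun x hx => (Finset.mem_filter.1 hx).2
  have hcard : (Fintype.piFinset fun _ : Fin 2 => Finset.range L).card = L ^ 2 := by simp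
  rw [← hcard]
  refine Finset.card_le_card_of_injOn (fun x μ => (x μ : ℕ) - (y.1 μ : ℕ)) ?_ ?_
  · intro x hx
    simp only [Finset.mem_coe, Fintype.mem_piFinset, Finset.mem_range]
    intro μ
    have := h x hx μ
    omega
  · intro x hx x' hx' hxx
    funext μ
    have h1 := h x hx μ
    have h2 := h x' hx' μ
    have h3 := congrFun hxx μ
    simp only at h3
    exact Fin.ext (by omega)

theorem label_coe {n L : ℕ} (hL : 0 < L) (y : CSite n L) : label n L y.1 = y :=
  ((mem_box_iff n L hL _ _).1 (Finset.mem_filter.2 ⟨Finset.mem_univ _, fun _ => by omega⟩)).symm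

theorem sum_label_eq {n L : ℕ} (hL : 0 < L) (g : CSite n L → ℝ) :
    ∑ x, g (label n L x) = ∑ y, ((box n L y).card : ℝ) * g y := by
  rw [← Finset.sum_fiberwise Finset.univ (label n L)]
  refine Finset.sum_congr rfl fun y _ => ?_
  rw [Finset.sum_congr rfl (g := fun _ => g y) fun x hx => by rw [(Finset.mem_filter.1 hx).2],
    Finset.sum_const, nsmul_eq_mul]
  congr 3
  ext x
  simp [mem_box_iff n L hL, eq_comm]

theorem one_le_card_box {n L : ℕ} (hL : 0 < L) (y : CSite n L) : 1 ≤ (box n L y).card :=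
  Finset.card_pos.2 ⟨y.1, (mem_box_iff n L hL _ _).2 (label_coe hL y).symm⟩

/-- Boxes at the boundary are truncated when `L` does not divide `n`. A box has between 1 and `L²`
sites, so fine and coarse sums are compared by inequalities only. -/
theorem sum_label_le {n L : ℕ} (hL : 0 < L) {g : CSite n L → ℝ} (hg : ∀ y, 0 ≤ g y) :
    ∑ x, g (label n L x) ≤ (L : ℝ) ^ 2 * ∑ y, g y := by
  rw [sum_label_eq hL, Finset.mul_sum]
  exact Finset.sum_le_sum fun y _ =>
    mul_le_mul_of_nonneg_right (by exact_mod_cast card_box_le n L y) (hg y)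

theorem le_sum_label {n L : ℕ} (hL : 0 < L) {g : CSite n L → ℝ} (hg : ∀ y, 0 ≤ g y) :
    ∑ y, g y ≤ ∑ x, g (label n L x) := by
  rw [sum_label_eq hL]
  exact Finset.sum_le_sum fun y _ =>
    le_mul_of_one_le_left (hg y) (by exact_mod_cast one_le_card_box hL y)

/-- A bond is determined by its direction and either one of its ends, so a site is the initial end
of at most two bonds and the final end of at most two. -/
theorem sum_bond_le {n : ℕ} {h : Site n → ℝ} (hh : ∀ x, 0 ≤ h x) :
    ∑ b : Bond n, (h b.1.1 + h b.1.2) ≤ 4 * ∑ x, h x := by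
  have hS : ∑ p : Site n × Fin 2, h p.1 = 2 * ∑ x, h x := by
    rw [Fintype.sum_prod_type]
    simp [← Finset.mul_sum]
  choose d hd using fun b : Bond n => b.2
  have h1 : Function.Injective fun b : Bond n => ((b.1.1, d b) : Site n × Fin 2) := by
    intro b b' hbb
    simp only [Prod.mk.injEq] at hbb
    refine Subtype.ext (Prod.ext hbb.1 (funext fun ν => ?_))
    have e1 := hd b
    have e2 := hd b'
    rw [← hbb.2, ← hbb.1] at e2
    by_cases hν : ν = d b
    · subst hν; exact Fin.ext (by omega)
    · rw [e1.2 ν hν, e2.2 ν hν]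
  have h2 : Function.Injective fun b : Bond n => ((b.1.2, d b) : Site n × Fin 2) := by
    intro b b' hbb
    simp only [Prod.mk.injEq] at hbb
    refine Subtype.ext (Prod.ext (funext fun ν => ?_) hbb.1)
    have e1 := hd b
    have e2 := hd b'
    rw [← hbb.2, ← hbb.1] at e2
    by_cases hν : ν = d b
    · subst hν; exact Fin.ext (by omega)
    · rw [← e1.2 ν hν, ← e2.2 ν hν]
  rw [Finset.sum_add_distrib]
  have i1 := sum_comp_le_of_injective h1 (g := fun p => h p.1) fun p => hh _
  have i2 := sum_comp_le_of_injective h2 (g := fun p => h p.1) fun p => hh _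
  rw [hS] at i1 i2
  simp only at i1 i2
  linarith

/-- The labels of the two ends of a bond agree, or form a bond of the coarse lattice. -/
theorem label_bond {n L : ℕ} (b : Bond n) :
    label n L b.1.1 = label n L b.1.2 ∨
      ∃ b' : CBond n L, b'.1 = (label n L b.1.1, label n L b.1.2) := by
  obtain ⟨⟨x, x'⟩, μ, h1, h2⟩ := b
  simp only at h1 h2 ⊢
  have hν : ∀ ν, ν ≠ μ → (label n L x').1 ν = (label n L x).1 ν := fun ν hν =>
    Fin.ext (by simp [label, h2 ν hν])
  have hμ : (x' μ : ℕ) / L = (x μ : ℕ) / L ∨ (x' μ : ℕ) / L = (x μ : ℕ) / L + 1 := by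
    rw [h1, Nat.succ_div]
    split_ifs <;> simp
  rcases hμ with hμ | hμ
  · left
    refine Subtype.ext (funext fun ν => ?_)
    by_cases h : ν = μ
    · subst h; exact Fin.ext (by simp [label, hμ])
    · exact (hν ν h).symm
  · right
    exact ⟨⟨(label n L x, label n L x'), μ, by simp only [label, hμ]; ring, hν⟩, rfl⟩

/-! ### Poincaré inequality -/

theorem avg_apply {n L : ℕ} (f : VField n) (y : CSite n L) :
    avg n L f y = ((L : ℝ) ^ 2)⁻¹ • ∑ x ∈ box n L y, f x := rfl

theorem avgAdj_apply {n L : ℕ} (f : CField n L) (x : Site n) :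
    avgAdj n L f x = f (label n L x) := rfl

theorem grad_apply {n : ℕ} (f : VField n) (b : Bond n) : grad n f b = f b.1.1 - f b.1.2 := rfl

/-- The Dirichlet energy of the bonds that start in the box of `y`. -/
noncomputable def boxEnergy {n L : ℕ} (f : VField n) (y : CSite n L) : ℝ :=
  ∑ b : Bond n with label n L b.1.1 = y, ‖grad n f b‖ ^ 2

theorem boxEnergy_nonneg {n L : ℕ} (f : VField n) (y : CSite n L) : 0 ≤ boxEnergy f y :=
  Finset.sum_nonneg fun _ _ => by positivity

theorem sum_boxEnergy {n L : ℕ} (f : VField n) :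
    ∑ y : CSite n L, boxEnergy f y = ∑ b, ‖grad n f b‖ ^ 2 :=
  Finset.sum_fiberwise Finset.univ (fun b : Bond n => label n L b.1.1) _

theorem norm_grad_le_sqrt_boxEnergy {n L : ℕ} (f : VField n) (b : Bond n) :
    ‖grad n f b‖ ≤ √(boxEnergy f (label n L b.1.1)) := by
  refine Real.le_sqrt_of_sq_le ?_
  exact Finset.single_le_sum (f := fun b => ‖grad n f b‖ ^ 2) (fun _ _ => by positivity)
    (Finset.mem_filter.2 ⟨Finset.mem_univ b, rfl⟩)

/-- Walk from `x` to the lowest corner by lowering one coordinate at a time. The walk stays in the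
box, even in a truncated one, and each step costs at most the root of the box energy. -/
theorem norm_sub_corner_le_aux {n L : ℕ} (hL : 0 < L) (f : VField n) (y : CSite n L) (k : ℕ) :
    ∀ x, label n L x = y → ∑ μ, ((x μ : ℕ) - (y.1 μ : ℕ)) = k →
      ‖f x - f y.1‖ ≤ k * √(boxEnergy f y) := by
  induction k with
  | zero =>
    intro x hx hk
    have hb := (Finset.mem_filter.1 ((mem_box_iff n L hL x y).2 hx.symm)).2
    have : x = y.1 := funext fun μ => Fin.ext (by
      have h1 := (Finset.sum_eq_zero_iff.1 hk) μ (Finset.mem_univ _)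
      have := hb μ
      omega)
    simp [this]
  | succ k ih =>
    intro x hx hk
    have hb := (Finset.mem_filter.1 ((mem_box_iff n L hL x y).2 hx.symm)).2
    obtain ⟨μ, -, hμ⟩ := Finset.exists_ne_zero_of_sum_ne_zero (by rw [hk]; omega)
    have hxμ : (x μ : ℕ) - 1 < n := by have := (x μ).isLt; omega
    set x' : Site n := Function.update x μ ⟨(x μ : ℕ) - 1, hxμ⟩ with hx'
    have hx'μ : (x' μ : ℕ) = (x μ : ℕ) - 1 := by simp [hx']
    have hx'ν : ∀ ν, ν ≠ μ → x' ν = x ν := fun ν hν => by simp [hx', hν]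
    have hlab : label n L x' = y := by
      refine ((mem_box_iff n L hL _ _).1 (Finset.mem_filter.2 ⟨Finset.mem_univ _, fun ν => ?_⟩)).symm
      have := hb ν
      by_cases h : ν = μ
      · subst h; omega
      · rw [hx'ν ν h]; exact this
    have hsum : ∑ ν, ((x' ν : ℕ) - (y.1 ν : ℕ)) = k := by
      have e1 := Finset.add_sum_erase Finset.univ (fun ν => (x ν : ℕ) - (y.1 ν : ℕ))
        (Finset.mem_univ μ)
      have e2 := Finset.add_sum_erase Finset.univ (fun ν => (x' ν : ℕ) - (y.1 ν : ℕ))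
        (Finset.mem_univ μ)
      have e3 : ∑ ν ∈ Finset.univ.erase μ, ((x' ν : ℕ) - (y.1 ν : ℕ))
          = ∑ ν ∈ Finset.univ.erase μ, ((x ν : ℕ) - (y.1 ν : ℕ)) :=
        Finset.sum_congr rfl fun ν hν => by rw [hx'ν ν (Finset.ne_of_mem_erase hν)]
      omega
    -- Oriented from `x'` to `x`, the bond starts in the box of `y` and so is counted in `boxEnergy
    -- f y`.
    let b : Bond n := ⟨(x', x), μ, by simp only; omega, fun ν hν => (hx'ν ν hν).symm⟩
    have hbnd := norm_grad_le_sqrt_boxEnergy (L := L) f b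
    change ‖f x' - f x‖ ≤ √(boxEnergy f (label n L x')) at hbnd
    rw [hlab, norm_sub_rev] at hbnd
    calc ‖f x - f y.1‖ ≤ ‖f x - f x'‖ + ‖f x' - f y.1‖ := norm_sub_le_norm_sub_add_norm_sub _ _ _
      _ ≤ √(boxEnergy f y) + k * √(boxEnergy f y) := add_le_add hbnd (ih x' hlab hsum)
      _ = _ := by push_cast; ring

theorem norm_sub_corner_le {n L : ℕ} (hL : 0 < L) (f : VField n) (x : Site n) :
    ‖f x - f (label n L x).1‖ ≤ 2 * L * √(boxEnergy f (label n L x)) := by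
  refine (norm_sub_corner_le_aux hL f _ _ x rfl rfl).trans ?_
  refine mul_le_mul_of_nonneg_right ?_ (Real.sqrt_nonneg _)
  have hb := (Finset.mem_filter.1 ((mem_box_iff n L hL x _).2 rfl)).2
  have : ∑ μ, ((x μ : ℕ) - ((label n L x).1 μ : ℕ)) ≤ ∑ _μ : Fin 2, L :=
    Finset.sum_le_sum fun μ _ => by have := hb μ; omega
  simp only [Finset.sum_const, Finset.card_univ, Fintype.card_fin, smul_eq_mul] at this
  exact_mod_cast this

/-- All values in the box are close to the corner value, and `L²` times the average is the number
`m` of sites times the corner value, up to such differences. Division by `m ≥ 1` is harmless in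
truncated boxes too. -/
theorem norm_le_avg_add_boxEnergy {n L : ℕ} (hL : 0 < L) (f : VField n) (x : Site n) :
    ‖f x‖ ≤ (L : ℝ) ^ 2 * ‖avg n L f (label n L x)‖
      + 4 * L * √(boxEnergy f (label n L x)) := by
  set y := label n L x with hy
  set E := √(boxEnergy f y)
  have hL2 : (0 : ℝ) < (L : ℝ) ^ 2 := by positivity
  set m : ℝ := ((box n L y).card : ℝ) with hm
  have hm1 : 1 ≤ m := by
    rw [hm]
    exact_mod_cast one_le_card_box hL y
  have h1 : (L : ℝ) ^ 2 • avg n L f y = ∑ z ∈ box n L y, f z := by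
    rw [avg_apply, smul_inv_smul₀ hL2.ne']
  have h2 : m • f y.1 = (L : ℝ) ^ 2 • avg n L f y - ∑ z ∈ box n L y, (f z - f y.1) := by
    rw [h1, Finset.sum_sub_distrib, Finset.sum_const, hm, Nat.cast_smul_eq_nsmul]
    abel
  have h3 : ‖∑ z ∈ box n L y, (f z - f y.1)‖ ≤ m * (2 * L * E) := by
    refine (norm_sum_le_of_le _ (f := fun z => f z - f y.1) (n := fun _ => 2 * L * E)
      fun z hz => ?_).trans (by simp [hm])
    have hz' := (mem_box_iff n L hL z y).1 hz
    have := norm_sub_corner_le hL f z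
    rwa [← hz'] at this
  have h4 : m * ‖f y.1‖ ≤ (L : ℝ) ^ 2 * ‖avg n L f y‖ + m * (2 * L * E) := by
    rw [← Real.norm_of_nonneg (zero_le_one.trans hm1), ← norm_smul, h2,
      Real.norm_of_nonneg (zero_le_one.trans hm1)]
    refine (norm_sub_le _ _).trans (add_le_add ?_ h3)
    rw [norm_smul, Real.norm_of_nonneg hL2.le]
  have h5 : ‖f y.1‖ ≤ (L : ℝ) ^ 2 * ‖avg n L f y‖ + 2 * L * E := by
    have : m * (‖f y.1‖ - 2 * L * E) ≤ (L : ℝ) ^ 2 * ‖avg n L f y‖ := by linarith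
    by_cases h : 0 ≤ ‖f y.1‖ - 2 * L * E
    · nlinarith
    · have : 0 ≤ (L : ℝ) ^ 2 * ‖avg n L f y‖ := by positivity
      linarith
  have h6 := norm_sub_corner_le hL f x
  rw [← hy] at h6
  have h7 := norm_le_norm_sub_add (f x) (f y.1)
  linarith

/-- The Poincaré inequality, with a constant that depends only on `L`. -/
theorem poincare {n L : ℕ} (hL : 0 < L) (f : VField n) :
    ∑ x, ‖f x‖ ^ 2 ≤ 32 * (L : ℝ) ^ 4 *
      (∑ b, ‖grad n f b‖ ^ 2 + (L : ℝ) ^ 2 * ∑ y, ‖avg n L f y‖ ^ 2) := by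
  have hL1 : (1 : ℝ) ≤ L := by exact_mod_cast hL
  have h1 : ∀ x, ‖f x‖ ^ 2 ≤ 2 * (L : ℝ) ^ 4 * ‖avg n L f (label n L x)‖ ^ 2
      + 32 * (L : ℝ) ^ 2 * boxEnergy f (label n L x) := by
    intro x
    have h := norm_le_avg_add_boxEnergy hL f x
    have hE := Real.sq_sqrt (boxEnergy_nonneg f (label n L x))
    set E := √(boxEnergy f (label n L x))
    rw [← hE]
    calc ‖f x‖ ^ 2 ≤ ((L : ℝ) ^ 2 * ‖avg n L f (label n L x)‖ + 4 * L * E) ^ 2 := by gcongr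
      _ ≤ _ := by nlinarith [sq_nonneg ((L : ℝ) ^ 2 * ‖avg n L f (label n L x)‖ - 4 * L * E)]
  refine (Finset.sum_le_sum fun x _ => h1 x).trans ?_
  refine (sum_label_le hL (g := fun y => 2 * (L : ℝ) ^ 4 * ‖avg n L f y‖ ^ 2
      + 32 * (L : ℝ) ^ 2 * boxEnergy f y) fun y => ?_).trans ?_
  · have := boxEnergy_nonneg f y
    positivity
  · rw [Finset.sum_add_distrib, ← Finset.mul_sum, ← Finset.mul_sum, sum_boxEnergy]
    have : 0 ≤ ∑ y, ‖avg n L f y‖ ^ 2 := Finset.sum_nonneg fun _ _ => by positivity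
    have h6 : 0 ≤ (L : ℝ) ^ 6 * ∑ y, ‖avg n L f y‖ ^ 2 := by positivity
    nlinarith

/-! ### Weighted energy estimates -/

theorem inner_hamiltonian {n L : ℕ} (hL : 0 < L) (v f : VField n) :
    ∑ x, inner ℝ (v x) (hamiltonian n L f x)
      = ∑ b, inner ℝ (grad n v b) (grad n f b)
        + (L : ℝ) ^ 2 * ∑ y, inner ℝ (avg n L v y) (avg n L f y) := by
  rw [inner_grad, inner_avg n L hL, ← Finset.sum_add_distrib]
  refine Finset.sum_congr rfl fun x _ => ?_
  rw [← inner_add_right]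
  rfl

/-- Positive weights on the coarse lattice that vary slowly across its bonds. -/
structure IsWeight {n L : ℕ} (κ : ℝ) (s : CSite n L → ℝ) : Prop where
  pos : ∀ y, 0 < s y
  slow : ∀ b : CBond n L, (s b.1.1 - s b.1.2) ^ 2 ≤ κ * (s b.1.1 * s b.1.2)

theorem IsWeight.slow_label {n L : ℕ} {κ : ℝ} (hκ : 0 ≤ κ) {s : CSite n L → ℝ}
    (hs : IsWeight κ s) (b : Bond n) :
    (s (label n L b.1.1) - s (label n L b.1.2)) ^ 2
      ≤ κ * (s (label n L b.1.1) * s (label n L b.1.2)) := by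
  rcases label_bond (L := L) b with h | ⟨b', hb'⟩
  · rw [h]
    have := hs.pos (label n L b.1.2)
    simp only [sub_self, ne_eq, OfNat.ofNat_ne_zero, not_false_eq_true, zero_pow]
    positivity
  · have := hs.slow b'
    rwa [hb'] at this

/-- Weights live on the coarse lattice so that they are constant on boxes and commute with `Q`;
conjugation then affects only the gradient term. -/
theorem avg_weight_smul {n L : ℕ} (hL : 0 < L) (w : CSite n L → ℝ) (f : VField n)
    (y : CSite n L) : avg n L (fun x => w (label n L x) • f x) y = w y • avg n L f y := by
  rw [avg_apply, avg_apply, smul_comm (w y)]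
  congr 1
  rw [Finset.smul_sum]
  refine Finset.sum_congr rfl fun x hx => ?_
  rw [← (mem_box_iff n L hL x y).1 hx]

theorem norm_avg_sq_le {n L : ℕ} (hL : 0 < L) (f : VField n) (y : CSite n L) :
    (L : ℝ) ^ 2 * ‖avg n L f y‖ ^ 2 ≤ ∑ x ∈ box n L y, ‖f x‖ ^ 2 := by
  have hL2 : (0 : ℝ) < (L : ℝ) ^ 2 := by positivity
  have h1 : ‖avg n L f y‖ ≤ ((L : ℝ) ^ 2)⁻¹ * ∑ x ∈ box n L y, ‖f x‖ := by
    rw [avg_apply, norm_smul, Real.norm_of_nonneg (inv_nonneg.2 hL2.le)]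
    gcongr
    exact norm_sum_le _ _
  have h2 := sq_sum_le_card_mul_sum_sq (s := box n L y) (f := fun x => ‖f x‖)
  have h3 : ((box n L y).card : ℝ) ≤ (L : ℝ) ^ 2 := by exact_mod_cast card_box_le n L y
  have h4 : 0 ≤ ∑ x ∈ box n L y, ‖f x‖ ^ 2 := Finset.sum_nonneg fun _ _ => by positivity
  calc (L : ℝ) ^ 2 * ‖avg n L f y‖ ^ 2
      ≤ (L : ℝ) ^ 2 * (((L : ℝ) ^ 2)⁻¹ * ∑ x ∈ box n L y, ‖f x‖) ^ 2 := by gcongr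
    _ = ((L : ℝ) ^ 2)⁻¹ * (∑ x ∈ box n L y, ‖f x‖) ^ 2 := by field_simp
    _ ≤ ((L : ℝ) ^ 2)⁻¹ * ((L : ℝ) ^ 2 * ∑ x ∈ box n L y, ‖f x‖ ^ 2) := by
        gcongr
        exact h2.trans (by gcongr)
    _ = _ := by field_simp

theorem sum_box {n L : ℕ} (hL : 0 < L) (h : Site n → ℝ) :
    ∑ y, ∑ x ∈ box n L y, h x = ∑ x, h x := by
  rw [← Finset.sum_fiberwise Finset.univ (label n L)]
  refine Finset.sum_congr rfl fun y _ => Finset.sum_congr ?_ fun _ _ => rfl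
  ext x
  simp [mem_box_iff n L hL, eq_comm]

/-- The right side equals `‖s₁a - s₂b‖² - (s₁ - s₂)²⟨a, b⟩`, and slow variation bounds the last term
by `κ s₁s₂‖a‖‖b‖`. -/
theorem grad_weight_lower {κ s₁ s₂ : ℝ} (h1 : 0 < s₁) (h2 : 0 < s₂)
    (h : (s₁ - s₂) ^ 2 ≤ κ * (s₁ * s₂)) (a b : Vec) :
    ‖s₁ • a - s₂ • b‖ ^ 2 - κ / 2 * (‖s₁ • a‖ ^ 2 + ‖s₂ • b‖ ^ 2)
      ≤ inner ℝ (s₁ ^ 2 • a - s₂ ^ 2 • b) (a - b) := by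
  have e : inner ℝ (s₁ ^ 2 • a - s₂ ^ 2 • b) (a - b)
      = s₁ ^ 2 * ‖a‖ ^ 2 + s₂ ^ 2 * ‖b‖ ^ 2 - (s₁ ^ 2 + s₂ ^ 2) * inner ℝ a b := by
    simp only [inner_sub_left, inner_sub_right, real_inner_smul_left, real_inner_self_eq_norm_sq,
      real_inner_comm a b]
    ring
  have hab := abs_real_inner_le_norm a b
  have hκ : (s₁ - s₂) ^ 2 * inner ℝ a b ≤ κ * (s₁ * s₂) * (‖a‖ * ‖b‖) := by
    calc (s₁ - s₂) ^ 2 * inner ℝ a b ≤ (s₁ - s₂) ^ 2 * (‖a‖ * ‖b‖) := by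
          gcongr; exact (le_abs_self _).trans hab
      _ ≤ _ := by gcongr
  have hκ0 : 0 ≤ κ := by
    by_contra hneg
    have : κ * (s₁ * s₂) < 0 := mul_neg_of_neg_of_pos (not_le.1 hneg) (by positivity)
    nlinarith [sq_nonneg (s₁ - s₂)]
  rw [e, norm_sub_sq_real, norm_smul, norm_smul, real_inner_smul_left, real_inner_smul_right,
    Real.norm_of_nonneg h1.le, Real.norm_of_nonneg h2.le]
  nlinarith [mul_nonneg hκ0 (sq_nonneg (s₁ * ‖a‖ - s₂ * ‖b‖))]

/-- Coercivity of `-Δ_Ω + Q*Q` in weighted `ℓ²`. -/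
theorem weighted_coercive {n L : ℕ} (hL : 0 < L) {κ : ℝ} (hκ0 : 0 ≤ κ)
    (hκ : κ ≤ 1 / (128 * (L : ℝ) ^ 4)) {s : CSite n L → ℝ} (hs : IsWeight κ s) (f : VField n) :
    ∑ x, s (label n L x) ^ 2 * ‖f x‖ ^ 2
      ≤ 64 * (L : ℝ) ^ 4 * ∑ x, s (label n L x) ^ 2 * inner ℝ (f x) (hamiltonian n L f x) := by
  have hL0 : (0 : ℝ) < L := by exact_mod_cast hL
  set u : VField n := fun x => s (label n L x) • f x with hu
  set v : VField n := fun x => s (label n L x) ^ 2 • f x with hv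
  have hun : ∀ x, ‖u x‖ ^ 2 = s (label n L x) ^ 2 * ‖f x‖ ^ 2 := fun x => by
    rw [hu, norm_smul, mul_pow, Real.norm_eq_abs, sq_abs]
  have e1 : ∑ x, s (label n L x) ^ 2 * inner ℝ (f x) (hamiltonian n L f x)
      = ∑ x, inner ℝ (v x) (hamiltonian n L f x) :=
    Finset.sum_congr rfl fun x _ => by rw [hv, real_inner_smul_left]
  have e2 : ∑ y, inner ℝ (avg n L v y) (avg n L f y) = ∑ y, ‖avg n L u y‖ ^ 2 :=
    Finset.sum_congr rfl fun y _ => by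
      rw [hv, hu, avg_weight_smul hL (fun y => s y ^ 2), avg_weight_smul hL s,
        real_inner_smul_left, norm_smul, mul_pow, Real.norm_eq_abs, sq_abs,
        real_inner_self_eq_norm_sq]
  have e3 : ∑ b, ‖grad n u b‖ ^ 2 - κ / 2 * (4 * ∑ x, ‖u x‖ ^ 2)
      ≤ ∑ b, inner ℝ (grad n v b) (grad n f b) := by
    have h4 := sum_bond_le (h := fun x => ‖u x‖ ^ 2) fun x => by positivity
    calc ∑ b, ‖grad n u b‖ ^ 2 - κ / 2 * (4 * ∑ x, ‖u x‖ ^ 2)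
        ≤ ∑ b, ‖grad n u b‖ ^ 2 - κ / 2 * ∑ b : Bond n, (‖u b.1.1‖ ^ 2 + ‖u b.1.2‖ ^ 2) := by
          gcongr
      _ = ∑ b : Bond n, (‖grad n u b‖ ^ 2 - κ / 2 * (‖u b.1.1‖ ^ 2 + ‖u b.1.2‖ ^ 2)) := by
          rw [Finset.mul_sum, ← Finset.sum_sub_distrib]
      _ ≤ _ := Finset.sum_le_sum fun b _ =>
          grad_weight_lower (hs.pos _) (hs.pos _) (hs.slow_label hκ0 b) _ _
  have hP := poincare hL u
  rw [e1, inner_hamiltonian hL, e2]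
  simp only [← hun]
  set U := ∑ x, ‖u x‖ ^ 2
  have hU : 0 ≤ U := Finset.sum_nonneg fun _ _ => by positivity
  set R := ∑ b, ‖grad n u b‖ ^ 2
  set A := (L : ℝ) ^ 2 * ∑ y, ‖avg n L u y‖ ^ 2
  -- Poincaré gives `2U ≤ 64L⁴(R + A)`. The conjugation error is `64L⁴ · 2κU`, and the assumed size
  -- of `κ` makes it at most `U`.
  have h5 : 128 * (L : ℝ) ^ 4 * κ ≤ 1 := by
    rw [le_div_iff₀ (by positivity)] at hκ
    linarith
  have h6 : 64 * (L : ℝ) ^ 4 * (R - κ / 2 * (4 * U) + A)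
      ≤ 64 * (L : ℝ) ^ 4 * (∑ b, inner ℝ (grad n v b) (grad n f b) + A) := by gcongr
  nlinarith [mul_le_mul_of_nonneg_right h5 hU]

theorem real_inner_le_young {E : Type*} [NormedAddCommGroup E] [InnerProductSpace ℝ E] {η : ℝ}
    (hη : 0 < η) (a b : E) : inner ℝ a b ≤ η / 2 * ‖a‖ ^ 2 + 1 / (2 * η) * ‖b‖ ^ 2 := by
  have h := real_inner_le_norm a b
  have h2 : η / 2 * ‖a‖ ^ 2 + 1 / (2 * η) * ‖b‖ ^ 2 - ‖a‖ * ‖b‖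
      = 1 / (2 * η) * (η * ‖a‖ - ‖b‖) ^ 2 := by field_simp; ring
  have h3 : 0 ≤ 1 / (2 * η) * (η * ‖a‖ - ‖b‖) ^ 2 := by positivity
  linarith

/-- Invertibility of `-Δ_Ω + Q*Q` in weighted `ℓ²`. -/
theorem weighted_hamiltonian_lower {n L : ℕ} (hL : 0 < L) {κ : ℝ} (hκ0 : 0 ≤ κ)
    (hκ : κ ≤ 1 / (128 * (L : ℝ) ^ 4)) {s : CSite n L → ℝ} (hs : IsWeight κ s) (f : VField n) :
    ∑ x, s (label n L x) ^ 2 * ‖f x‖ ^ 2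
      ≤ (64 * (L : ℝ) ^ 4) ^ 2 * ∑ x, s (label n L x) ^ 2 * ‖hamiltonian n L f x‖ ^ 2 := by
  have hL0 : (0 : ℝ) < L := by exact_mod_cast hL
  have h := weighted_coercive hL hκ0 hκ hs f
  set K : ℝ := 64 * (L : ℝ) ^ 4 with hK
  have hK0 : 0 < K := by positivity
  -- Young with parameter `K⁻¹`: after multiplication by `K` half of the left side is absorbed.
  have h2 : ∑ x, s (label n L x) ^ 2 * inner ℝ (f x) (hamiltonian n L f x)
      ≤ K⁻¹ / 2 * ∑ x, s (label n L x) ^ 2 * ‖f x‖ ^ 2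
        + 1 / (2 * K⁻¹) * ∑ x, s (label n L x) ^ 2 * ‖hamiltonian n L f x‖ ^ 2 := by
    rw [Finset.mul_sum, Finset.mul_sum, ← Finset.sum_add_distrib]
    refine Finset.sum_le_sum fun x _ => ?_
    have := mul_le_mul_of_nonneg_left (real_inner_le_young (inv_pos.2 hK0) (f x)
      (hamiltonian n L f x)) (sq_nonneg (s (label n L x)))
    linarith
  set F := ∑ x, s (label n L x) ^ 2 * ‖f x‖ ^ 2
  set G := ∑ x, s (label n L x) ^ 2 * ‖hamiltonian n L f x‖ ^ 2
  have h3 := h.trans (mul_le_mul_of_nonneg_left h2 hK0.le)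
  have h4 : K * (K⁻¹ / 2 * F + 1 / (2 * K⁻¹) * G) = F / 2 + K ^ 2 / 2 * G := by field_simp
  linarith

/-- Slow variation makes neighbouring weights comparable within a factor 3, so one factor `s` can be
moved onto each argument before Young's inequality. -/
theorem grad_weight_upper {s₁ s₂ η : ℝ} (h1 : 0 < s₁) (h2 : 0 < s₂)
    (h : (s₁ - s₂) ^ 2 ≤ s₁ * s₂) (hη : 0 < η) (v₁ v₂ f₁ f₂ : Vec) :
    inner ℝ (s₁ ^ 2 • v₁ - s₂ ^ 2 • v₂) (f₁ - f₂)
      ≤ 3 * η * (s₁ ^ 2 * ‖v₁‖ ^ 2 + s₂ ^ 2 * ‖v₂‖ ^ 2)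
        + 3 / η * (s₁ ^ 2 * ‖f₁‖ ^ 2 + s₂ ^ 2 * ‖f₂‖ ^ 2) := by
  have h12 : s₁ ≤ 3 * s₂ := by
    by_contra hc
    nlinarith [mul_pos h1 (sub_pos.2 (not_le.1 hc))]
  have h21 : s₂ ≤ 3 * s₁ := by
    by_contra hc
    nlinarith [mul_pos h2 (sub_pos.2 (not_le.1 hc))]
  have e : inner ℝ (s₁ ^ 2 • v₁ - s₂ ^ 2 • v₂) (f₁ - f₂)
      ≤ (s₁ ^ 2 * ‖v₁‖ + s₂ ^ 2 * ‖v₂‖) * (‖f₁‖ + ‖f₂‖) := by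
    refine (real_inner_le_norm _ _).trans ?_
    gcongr
    · refine (norm_sub_le _ _).trans (le_of_eq ?_)
      simp [norm_smul]
    · exact norm_sub_le _ _
  set a := ‖v₁‖
  set b := ‖v₂‖
  set p := ‖f₁‖
  set q := ‖f₂‖
  have ha : 0 ≤ a := norm_nonneg _
  have hb : 0 ≤ b := norm_nonneg _
  have hp : 0 ≤ p := norm_nonneg _
  have hq : 0 ≤ q := norm_nonneg _
  have e2 : (s₁ ^ 2 * a + s₂ ^ 2 * b) * (p + q)
      ≤ 3 * ((s₁ * a + s₂ * b) * (s₁ * p + s₂ * q)) := by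
    have i1 : s₁ * (s₁ * a * q) ≤ 3 * s₂ * (s₁ * a * q) := by gcongr
    have i2 : s₂ * (s₂ * b * p) ≤ 3 * s₁ * (s₂ * b * p) := by gcongr
    have i3 : 0 ≤ s₁ ^ 2 * a * p := by positivity
    have i4 : 0 ≤ s₂ ^ 2 * b * q := by positivity
    nlinarith
  have e3 : (s₁ * a + s₂ * b) * (s₁ * p + s₂ * q)
      ≤ η / 2 * (s₁ * a + s₂ * b) ^ 2 + 1 / (2 * η) * (s₁ * p + s₂ * q) ^ 2 := by
    have := real_inner_le_young hη (s₁ * a + s₂ * b) (s₁ * p + s₂ * q)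
    simpa [mul_comm] using this
  have e4 : η / 2 * (s₁ * a + s₂ * b) ^ 2 ≤ η / 2 * (2 * ((s₁ * a) ^ 2 + (s₂ * b) ^ 2)) := by
    gcongr
    nlinarith [sq_nonneg (s₁ * a - s₂ * b)]
  have e5 : 1 / (2 * η) * (s₁ * p + s₂ * q) ^ 2
      ≤ 1 / (2 * η) * (2 * ((s₁ * p) ^ 2 + (s₂ * q) ^ 2)) := by
    gcongr
    nlinarith [sq_nonneg (s₁ * p - s₂ * q)]
  have e6 : 3 / η * (s₁ ^ 2 * p ^ 2 + s₂ ^ 2 * q ^ 2)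
      = 3 * (1 / (2 * η) * (2 * ((s₁ * p) ^ 2 + (s₂ * q) ^ 2))) := by field_simp
  rw [e6]
  nlinarith

/-- Boundedness of `-Δ_Ω + Q*Q` in weighted `ℓ²`. -/
theorem weighted_hamiltonian_upper {n L : ℕ} (hL : 0 < L) {κ : ℝ} (hκ0 : 0 ≤ κ)
    (hκ : κ ≤ 1) {s : CSite n L → ℝ} (hs : IsWeight κ s) {η : ℝ} (hη : 0 < η) (v f : VField n) :
    ∑ x, s (label n L x) ^ 2 * inner ℝ (v x) (hamiltonian n L f x)
      ≤ 13 * η * ∑ x, s (label n L x) ^ 2 * ‖v x‖ ^ 2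
        + 13 / η * ∑ x, s (label n L x) ^ 2 * ‖f x‖ ^ 2 := by
  have hL0 : (0 : ℝ) < L := by exact_mod_cast hL
  set v' : VField n := fun x => s (label n L x) ^ 2 • v x with hv'
  set W : VField n → ℝ := fun g => ∑ x, s (label n L x) ^ 2 * ‖g x‖ ^ 2 with hW
  have hW0 : ∀ g, 0 ≤ W g := fun g => Finset.sum_nonneg fun _ _ => by positivity
  have e1 : ∑ x, s (label n L x) ^ 2 * inner ℝ (v x) (hamiltonian n L f x)
      = ∑ x, inner ℝ (v' x) (hamiltonian n L f x) :=
    Finset.sum_congr rfl fun x _ => by rw [hv', real_inner_smul_left]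
  have e2 : ∑ b, inner ℝ (grad n v' b) (grad n f b)
      ≤ 3 * η * (4 * W v) + 3 / η * (4 * W f) := by
    have hb : ∀ g : VField n, ∑ b : Bond n, (s (label n L b.1.1) ^ 2 * ‖g b.1.1‖ ^ 2
        + s (label n L b.1.2) ^ 2 * ‖g b.1.2‖ ^ 2) ≤ 4 * W g := fun g =>
      sum_bond_le (h := fun x => s (label n L x) ^ 2 * ‖g x‖ ^ 2) fun x => by positivity
    calc ∑ b, inner ℝ (grad n v' b) (grad n f b)
        ≤ ∑ b : Bond n, (3 * η * (s (label n L b.1.1) ^ 2 * ‖v b.1.1‖ ^ 2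
            + s (label n L b.1.2) ^ 2 * ‖v b.1.2‖ ^ 2)
          + 3 / η * (s (label n L b.1.1) ^ 2 * ‖f b.1.1‖ ^ 2
            + s (label n L b.1.2) ^ 2 * ‖f b.1.2‖ ^ 2)) := by
          refine Finset.sum_le_sum fun b _ => ?_
          refine grad_weight_upper (hs.pos _) (hs.pos _) ?_ hη _ _ _ _
          refine (hs.slow_label hκ0 b).trans ?_
          have := mul_pos (hs.pos (label n L b.1.1)) (hs.pos (label n L b.1.2))
          nlinarith
      _ = 3 * η * ∑ b : Bond n, (s (label n L b.1.1) ^ 2 * ‖v b.1.1‖ ^ 2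
            + s (label n L b.1.2) ^ 2 * ‖v b.1.2‖ ^ 2)
          + 3 / η * ∑ b : Bond n, (s (label n L b.1.1) ^ 2 * ‖f b.1.1‖ ^ 2
            + s (label n L b.1.2) ^ 2 * ‖f b.1.2‖ ^ 2) := by
          rw [Finset.sum_add_distrib, Finset.mul_sum, Finset.mul_sum]
      _ ≤ _ := by
          gcongr
          · exact hb v
          · exact hb f
  have e3 : ∀ g : VField n, ∑ y, s y ^ 2 * ((L : ℝ) ^ 2 * ‖avg n L g y‖ ^ 2) ≤ W g := by
    intro g
    simp only [hW]
    rw [← sum_box hL]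
    refine Finset.sum_le_sum fun y _ => ?_
    refine (mul_le_mul_of_nonneg_left (norm_avg_sq_le hL g y) (sq_nonneg _)).trans (le_of_eq ?_)
    rw [Finset.mul_sum]
    refine Finset.sum_congr rfl fun x hx => ?_
    rw [← (mem_box_iff n L hL x y).1 hx]
  have e4 : (L : ℝ) ^ 2 * ∑ y, inner ℝ (avg n L v' y) (avg n L f y)
      ≤ η / 2 * W v + 1 / (2 * η) * W f := by
    calc (L : ℝ) ^ 2 * ∑ y, inner ℝ (avg n L v' y) (avg n L f y)
        ≤ ∑ y, (η / 2 * (s y ^ 2 * ((L : ℝ) ^ 2 * ‖avg n L v y‖ ^ 2))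
          + 1 / (2 * η) * (s y ^ 2 * ((L : ℝ) ^ 2 * ‖avg n L f y‖ ^ 2))) := by
          rw [Finset.mul_sum]
          refine Finset.sum_le_sum fun y _ => ?_
          rw [hv', avg_weight_smul hL (fun y => s y ^ 2), real_inner_smul_left]
          have := mul_le_mul_of_nonneg_left (real_inner_le_young hη (avg n L v y) (avg n L f y))
            (show 0 ≤ (L : ℝ) ^ 2 * s y ^ 2 by positivity)
          linarith
      _ = η / 2 * ∑ y, s y ^ 2 * ((L : ℝ) ^ 2 * ‖avg n L v y‖ ^ 2)
          + 1 / (2 * η) * ∑ y, s y ^ 2 * ((L : ℝ) ^ 2 * ‖avg n L f y‖ ^ 2) := by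
          rw [Finset.sum_add_distrib, Finset.mul_sum, Finset.mul_sum]
      _ ≤ _ := by
          gcongr
          · exact e3 v
          · exact e3 f
  rw [e1, inner_hamiltonian hL]
  have e5 : 1 / (2 * η) * W f = 1 / η * W f / 2 := by field_simp
  have e6 : 3 / η * (4 * W f) = 12 * (1 / η * W f) := by ring
  have e7 : 13 / η * W f = 13 * (1 / η * W f) := by ring
  have h8 : 0 ≤ 1 / η * W f := mul_nonneg (by positivity) (hW0 f)
  have h9 : 0 ≤ η * W v := mul_nonneg hη.le (hW0 v)
  change _ ≤ 13 * η * W v + 13 / η * W f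
  rw [e7]
  rw [e6] at e2
  rw [e5] at e4
  linarith

/-- Invertibility of `Q G(Ω) Q*` in weighted `ℓ²`: here `f` stands for `G(Ω) Q* l`. -/
theorem weighted_coarse_lower {n L : ℕ} (hL : 0 < L) {κ : ℝ} (hκ0 : 0 ≤ κ)
    (hκ : κ ≤ 1 / (128 * (L : ℝ) ^ 4)) {s : CSite n L → ℝ} (hs : IsWeight κ s) {f : VField n}
    {l : CField n L} (hf : hamiltonian n L f = avgAdj n L l) :
    ∑ y, s y ^ 2 * ‖l y‖ ^ 2
      ≤ (676 * 64 * (L : ℝ) ^ 6) ^ 2 * ∑ y, s y ^ 2 * ‖avg n L f y‖ ^ 2 := by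
  have hL0 : (0 : ℝ) < L := by exact_mod_cast hL
  have hL1 : (1 : ℝ) ≤ L := by exact_mod_cast hL
  have hκ1 : κ ≤ 1 := by
    refine hκ.trans ?_
    rw [div_le_one (by positivity)]
    nlinarith [one_le_pow₀ hL1 (n := 4)]
  have h1 := weighted_coercive hL hκ0 hκ hs f
  -- Tested with `v = Q*l = Hf`, the left side is the weighted square norm of `Q*l`. With `η = 1/26`
  -- the coefficient `13η` is `1/2`, so this norm is absorbed and `2 · 13 · 26 = 676` remains.
  have h2 := weighted_hamiltonian_upper hL hκ0 hκ1 hs (η := 1 / 26) (by norm_num)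
    (avgAdj n L l) f
  rw [hf] at h1 h2
  simp only [real_inner_self_eq_norm_sq] at h2
  have h3 := le_sum_label hL (g := fun y => s y ^ 2 * ‖l y‖ ^ 2) fun y => by positivity
  have h4 : ∑ x, s (label n L x) ^ 2 * inner ℝ (f x) (avgAdj n L l x)
      = (L : ℝ) ^ 2 * ∑ y, s y ^ 2 * inner ℝ (avg n L f y) (l y) := by
    have := inner_avg n L hL f (fun y => s y ^ 2 • l y)
    simpa only [avgAdj_apply, real_inner_smul_right] using this.symm
  rw [h4] at h1
  simp only [avgAdj_apply] at h2
  set F := ∑ x, s (label n L x) ^ 2 * ‖f x‖ ^ 2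
  set Λ := ∑ y, s y ^ 2 * ‖l y‖ ^ 2
  set Φ := ∑ y, s y ^ 2 * ‖avg n L f y‖ ^ 2
  have h5 : Λ ≤ 676 * F := by
    norm_num at h2
    linarith
  set K : ℝ := 676 * 64 * (L : ℝ) ^ 6 with hK
  have hK0 : 0 < K := by positivity
  have h6 : ∑ y, s y ^ 2 * inner ℝ (avg n L f y) (l y) ≤ K / 2 * Φ + 1 / (2 * K) * Λ := by
    rw [Finset.mul_sum, Finset.mul_sum, ← Finset.sum_add_distrib]
    refine Finset.sum_le_sum fun y _ => ?_
    have := mul_le_mul_of_nonneg_left (real_inner_le_young hK0 (avg n L f y) (l y))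
      (sq_nonneg (s y))
    linarith
  have h7 : Λ ≤ K * (K / 2 * Φ + 1 / (2 * K) * Λ) := by
    calc Λ ≤ 676 * F := h5
      _ ≤ 676 * (64 * (L : ℝ) ^ 4 * ((L : ℝ) ^ 2 * (K / 2 * Φ + 1 / (2 * K) * Λ))) := by
          refine mul_le_mul_of_nonneg_left (h1.trans ?_) (by norm_num)
          gcongr
      _ = _ := by rw [hK]; ring
  have h8 : K * (K / 2 * Φ + 1 / (2 * K) * Λ) = K ^ 2 * Φ / 2 + Λ / 2 := by field_simp
  linarith

/-! ### Exponential weights and sup norm bounds -/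

/-- `t` to the power of the `ℓ¹` distance between block indices. The product form lets the sum over
`y` factor by coordinates. -/
noncomputable def expWeight {n L : ℕ} (t : ℝ) (y₀ y : CSite n L) : ℝ :=
  ∏ μ, t ^ ((((y.1 μ : ℕ) / L : ℕ) : ℤ) - (((y₀.1 μ : ℕ) / L : ℕ) : ℤ)).natAbs

/-- For exponents `k` and `k + 1` the claim reduces to `1 ≤ 2t`. -/
theorem pow_sub_pow_sq_le {t : ℝ} (ht : 1 / 2 ≤ t) {i j : ℕ} (hij : i ≤ j + 1)
    (hji : j ≤ i + 1) :
    (t ^ i - t ^ j) ^ 2 ≤ 2 * (1 - t) ^ 2 * (t ^ i * t ^ j) := by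
  have key : ∀ k : ℕ, (t ^ (k + 1) - t ^ k) ^ 2 ≤ 2 * (1 - t) ^ 2 * (t ^ (k + 1) * t ^ k) := by
    intro k
    have h : 0 ≤ (t ^ k) ^ 2 * (1 - t) ^ 2 * (2 * t - 1) := by
      have : 0 ≤ 2 * t - 1 := by linarith
      positivity
    rw [pow_succ t k]
    nlinarith
  have h0 : 0 < t := by linarith
  rcases (by omega : i = j ∨ i = j + 1 ∨ j = i + 1) with rfl | rfl | rfl
  · rw [sub_self, zero_pow two_ne_zero]
    positivity
  · exact key j
  · have := key i
    rw [mul_comm (t ^ i)]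
    linarith [sub_sq_comm (t ^ i) (t ^ (i + 1))]

theorem isWeight_expWeight {n L : ℕ} (hL : 0 < L) {t : ℝ} (ht : 1 / 2 ≤ t) (y₀ : CSite n L) :
    IsWeight (2 * (1 - t) ^ 2) (expWeight t y₀) := by
  have h0 : 0 < t := by linarith
  refine ⟨fun y => Finset.prod_pos fun μ _ => by positivity, ?_⟩
  rintro ⟨⟨y, y'⟩, μ, h1, h2⟩
  simp only at h1 h2 ⊢
  have hdiv : (y'.1 μ : ℕ) / L = (y.1 μ : ℕ) / L + 1 := by rw [h1, Nat.add_div_right _ hL]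
  have key : ∀ p q r : ℝ, (p - q) ^ 2 ≤ 2 * (1 - t) ^ 2 * (p * q) →
      (p * r - q * r) ^ 2 ≤ 2 * (1 - t) ^ 2 * (p * r * (q * r)) ∧
      (r * p - r * q) ^ 2 ≤ 2 * (1 - t) ^ 2 * (r * p * (r * q)) := by
    intro p q r h
    have := mul_le_mul_of_nonneg_right h (sq_nonneg r)
    constructor <;> linarith
  have hstep := pow_sub_pow_sq_le ht
    (i := ((((y.1 μ : ℕ) / L : ℕ) : ℤ) - (((y₀.1 μ : ℕ) / L : ℕ) : ℤ)).natAbs)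
    (j := ((((y'.1 μ : ℕ) / L : ℕ) : ℤ) - (((y₀.1 μ : ℕ) / L : ℕ) : ℤ)).natAbs)
    (by omega) (by omega)
  rw [expWeight, expWeight, Fin.prod_univ_two, Fin.prod_univ_two]
  fin_cases μ
  · rw [h2 1 (by decide)]
    exact (key _ _ _ hstep).1
  · rw [h2 0 (by decide)]
    exact (key _ _ _ hstep).2

theorem summable_pow_natAbs {r : ℝ} (h0 : 0 ≤ r) (h1 : r < 1) :
    Summable fun j : ℤ => r ^ j.natAbs := by
  refine Summable.of_nat_of_neg ?_ ?_ <;> simpa using summable_geometric_of_lt_one h0 h1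

/-- The block indices embed into a product of two copies of `ℤ`, so the sum is at most the square of
a two-sided geometric series, whatever `n` and `y₀`. -/
theorem sum_expWeight_sq_le {n L : ℕ} {t : ℝ} (h0 : 0 ≤ t) (h1 : t < 1)
    (y₀ : CSite n L) :
    ∑ y, expWeight t y₀ y ^ 2 ≤ (∑' j : ℤ, (t ^ 2) ^ j.natAbs) ^ 2 := by
  have hs := summable_pow_natAbs (sq_nonneg t) (by nlinarith : t ^ 2 < 1)
  let g : Fin 2 → Fin n → ℝ := fun μ i =>
    (t ^ 2) ^ (((i : ℕ) : ℤ) - (((y₀.1 μ : ℕ) / L : ℕ) : ℤ)).natAbs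
  let e : CSite n L → Fin 2 → Fin n := fun y μ =>
    ⟨(y.1 μ : ℕ) / L, (Nat.div_le_self _ _).trans_lt (y.1 μ).isLt⟩
  have he : Function.Injective e := by
    intro y y' h
    refine Subtype.ext (funext fun μ => Fin.ext ?_)
    have h' : (y.1 μ : ℕ) / L = (y'.1 μ : ℕ) / L := congrArg Fin.val (congrFun h μ)
    rw [← Nat.div_mul_cancel (y.2 μ), ← Nat.div_mul_cancel (y'.2 μ), h']
  have hg : ∀ μ i, 0 ≤ g μ i := fun μ i => by positivity
  have h2 : ∑ y, expWeight t y₀ y ^ 2 = ∑ y, ∏ μ, g μ (e y μ) := by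
    refine Finset.sum_congr rfl fun y _ => ?_
    rw [expWeight, ← Finset.prod_pow]
    refine Finset.prod_congr rfl fun μ _ => ?_
    rw [← pow_mul, mul_comm, pow_mul]
  have h3 : ∀ μ, ∑ i, g μ i ≤ ∑' j : ℤ, (t ^ 2) ^ j.natAbs := by
    intro μ
    have hinj : Function.Injective fun i : Fin n =>
        ((i : ℕ) : ℤ) - (((y₀.1 μ : ℕ) / L : ℕ) : ℤ) := by
      intro i j hij
      simp only at hij
      exact Fin.ext (by omega)
    have h4 := hs.sum_le_tsum (Finset.univ.map ⟨_, hinj⟩) fun j _ => by positivity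
    rwa [Finset.sum_map] at h4
  rw [h2]
  refine (sum_comp_le_of_injective he (g := fun z => ∏ μ, g μ (z μ))
    fun z => Finset.prod_nonneg fun μ _ => hg _ _).trans ?_
  have h5 := Finset.prod_univ_sum (fun _ : Fin 2 => (Finset.univ : Finset (Fin n))) g
  rw [Fintype.piFinset_univ] at h5
  rw [← h5, Fin.prod_univ_two, sq]
  exact mul_le_mul (h3 0) (h3 1) (Finset.sum_nonneg fun _ _ => hg _ _)
    (tsum_nonneg fun _ => by positivity)

theorem exists_weight {L : ℕ} (hL : 0 < L) :
    ∃ κ Z : ℝ, 0 ≤ κ ∧ κ ≤ 1 / (128 * (L : ℝ) ^ 4) ∧ 0 ≤ Z ∧ ∀ (n : ℕ) (y₀ : CSite n L),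
      ∃ s : CSite n L → ℝ, IsWeight κ s ∧ s y₀ = 1 ∧ ∑ y, s y ^ 2 ≤ Z := by
  have hL1 : (1 : ℝ) ≤ L := by exact_mod_cast hL
  have hL2 : (1 : ℝ) ≤ (L : ℝ) ^ 2 := one_le_pow₀ hL1
  -- This choice gives `2(1 - t)² = 1/(128 L⁴)`, exactly the largest `κ` allowed by coercivity.
  set t : ℝ := 1 - 1 / (16 * (L : ℝ) ^ 2) with ht
  have h1 : 1 / (16 * (L : ℝ) ^ 2) ≤ 1 / 16 := by
    apply one_div_le_one_div_of_le <;> linarith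
  have h2 : 0 < 1 / (16 * (L : ℝ) ^ 2) := by positivity
  refine ⟨2 * (1 - t) ^ 2, _, by positivity, le_of_eq ?_, sq_nonneg _, fun n y₀ =>
    ⟨expWeight t y₀, isWeight_expWeight hL (by linarith) y₀, by simp [expWeight],
      sum_expWeight_sq_le (by linarith) (by linarith) y₀⟩⟩
  rw [ht, sub_sub_cancel]
  field_simp
  norm_num

/-- Keep only the term `i` on the left, where the weight is 1, and take the sup of `g` out of the
sum on the right. -/
theorem norm_le_of_weighted {ι E F J : Type*} [Fintype ι] [Fintype J] [SeminormedAddCommGroup E]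
    [SeminormedAddCommGroup F] {K Z : ℝ} (hK : 0 ≤ K) (hZ : 0 ≤ Z) {l : ι → E} {g : J → F}
    (h : ∀ i, ∃ (a : ι → ℝ) (b : J → ℝ), a i = 1 ∧ ∑ j, b j ^ 2 ≤ Z ∧
      ∑ i, a i ^ 2 * ‖l i‖ ^ 2 ≤ K ^ 2 * ∑ j, b j ^ 2 * ‖g j‖ ^ 2) :
    ‖l‖ ≤ K * √Z * ‖g‖ := by
  refine (pi_norm_le_iff_of_nonneg (by positivity)).2 fun i => ?_
  obtain ⟨a, b, ha, hb, hab⟩ := h i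
  refine abs_le_of_sq_le_sq' ?_ (by positivity) |>.2
  calc ‖l i‖ ^ 2 = a i ^ 2 * ‖l i‖ ^ 2 := by rw [ha]; ring
    _ ≤ ∑ i, a i ^ 2 * ‖l i‖ ^ 2 :=
        Finset.single_le_sum (f := fun i => a i ^ 2 * ‖l i‖ ^ 2) (fun i _ => by positivity)
          (Finset.mem_univ i)
    _ ≤ K ^ 2 * ∑ j, b j ^ 2 * ‖g j‖ ^ 2 := hab
    _ ≤ K ^ 2 * ∑ j, b j ^ 2 * ‖g‖ ^ 2 := by
        gcongr with j
        exact norm_le_pi_norm g j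
    _ = K ^ 2 * ‖g‖ ^ 2 * ∑ j, b j ^ 2 := by rw [← Finset.sum_mul]; ring
    _ ≤ K ^ 2 * ‖g‖ ^ 2 * Z := by gcongr
    _ = (K * √Z * ‖g‖) ^ 2 := by rw [mul_pow, mul_pow, Real.sq_sqrt hZ]; ring

/-- `-Δ_Ω + Q*Q` is bounded below in the sup norm, uniformly in the volume. -/
theorem exists_hamiltonian_lower {L : ℕ} (hL : 0 < L) :
    ∃ C : ℝ, 0 < C ∧ ∀ (n : ℕ) (f : VField n), ‖f‖ ≤ C * ‖hamiltonian n L f‖ := by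
  obtain ⟨κ, Z, hκ0, hκ, hZ, hw⟩ := exists_weight hL
  refine ⟨64 * (L : ℝ) ^ 4 * √((L : ℝ) ^ 2 * Z) + 1, by positivity, fun n f => ?_⟩
  refine (norm_le_of_weighted (K := 64 * (L : ℝ) ^ 4) (Z := (L : ℝ) ^ 2 * Z) (by positivity)
    (by positivity) (g := hamiltonian n L f) fun x => ?_).trans
    (mul_le_mul_of_nonneg_right (by linarith) (norm_nonneg _))
  obtain ⟨s, hs, hs1, hsZ⟩ := hw n (label n L x)
  refine ⟨fun x => s (label n L x), fun x => s (label n L x), hs1, ?_,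
    weighted_hamiltonian_lower hL hκ0 hκ hs f⟩
  refine (sum_label_le hL (g := fun y => s y ^ 2) fun y => sq_nonneg _).trans ?_
  gcongr

/-- `Q G(Ω) Q*` is bounded below in the sup norm, uniformly in the volume. -/
theorem exists_coarse_lower {L : ℕ} (hL : 0 < L) :
    ∃ C : ℝ, 0 < C ∧ ∀ (n : ℕ) (f : VField n) (l : CField n L),
      hamiltonian n L f = avgAdj n L l → ‖l‖ ≤ C * ‖avg n L f‖ := by
  obtain ⟨κ, Z, hκ0, hκ, hZ, hw⟩ := exists_weight hL
  refine ⟨676 * 64 * (L : ℝ) ^ 6 * √Z + 1, by positivity, fun n f l hf => ?_⟩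
  refine (norm_le_of_weighted (K := 676 * 64 * (L : ℝ) ^ 6) (Z := Z) (by positivity)
    hZ (g := avg n L f) fun y => ?_).trans
    (mul_le_mul_of_nonneg_right (by linarith) (norm_nonneg _))
  obtain ⟨s, hs, hs1, hsZ⟩ := hw n y
  exact ⟨s, s, hs1, hsZ, weighted_coarse_lower hL hκ0 hκ hs hf⟩

/-! ### Inverses -/

theorem isUnit_of_norm_le {E : Type*} [NormedAddCommGroup E] [NormedSpace ℝ E]
    [FiniteDimensional ℝ E] {T : Module.End ℝ E} {C : ℝ} (h : ∀ v, ‖v‖ ≤ C * ‖T v‖) :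
    IsUnit T := by
  rw [LinearMap.isUnit_iff_ker_eq_bot, LinearMap.ker_eq_bot']
  intro v hv
  have := h v
  rw [hv, norm_zero, mul_zero] at this
  exact norm_le_zero_iff.1 this

theorem apply_ringInverse {E : Type*} [AddCommGroup E] [Module ℝ E] {T : Module.End ℝ E}
    (h : IsUnit T) (v : E) : T (Ring.inverse T v) = v :=
  congrArg (fun S : Module.End ℝ E => S v) (Ring.mul_inverse_cancel T h)

theorem norm_ringInverse_le {E : Type*} [NormedAddCommGroup E] [NormedSpace ℝ E]
    [FiniteDimensional ℝ E] {T : Module.End ℝ E} {C : ℝ} (h : ∀ v, ‖v‖ ≤ C * ‖T v‖) (v : E) :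
    ‖Ring.inverse T v‖ ≤ C * ‖v‖ := by
  have := h (Ring.inverse T v)
  rwa [apply_ringInverse (isUnit_of_norm_le h)] at this

/-! ### Elementary sup norm bounds -/

theorem norm_avg_le {n L : ℕ} (hL : 0 < L) (f : VField n) : ‖avg n L f‖ ≤ ‖f‖ := by
  have hL2 : (0 : ℝ) < (L : ℝ) ^ 2 := by positivity
  refine (pi_norm_le_iff_of_nonneg (norm_nonneg _)).2 fun y => ?_
  rw [avg_apply, norm_smul, Real.norm_of_nonneg (inv_nonneg.2 hL2.le), inv_mul_le_iff₀ hL2]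
  have h3 : ((box n L y).card : ℝ) ≤ (L : ℝ) ^ 2 := by exact_mod_cast card_box_le n L y
  refine (norm_sum_le_of_le _ fun x _ => norm_le_pi_norm f x).trans ?_
  rw [Finset.sum_const, nsmul_eq_mul]
  gcongr

theorem norm_avgAdj_le {n L : ℕ} (l : CField n L) : ‖avgAdj n L l‖ ≤ ‖l‖ :=
  (pi_norm_le_iff_of_nonneg (norm_nonneg _)).2 fun x => norm_le_pi_norm l (label n L x)

theorem norm_gradAdj_le {n : ℕ} (g : BField n) : ‖gradAdj n g‖ ≤ 4 * ‖g‖ := by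
  refine (pi_norm_le_iff_of_nonneg (by positivity)).2 fun x => ?_
  -- A function supported at `x` counts the bonds that meet `x`: at most four.
  have h := sum_bond_le (h := fun z => if z = x then ‖g‖ else 0) fun z => by positivity
  rw [Finset.sum_ite_eq' Finset.univ x, if_pos (Finset.mem_univ x)] at h
  refine le_trans ?_ h
  refine norm_sum_le_of_le _ fun b _ => (norm_sub_le _ _).trans (add_le_add ?_ ?_) <;>
  · split_ifs
    · exact norm_le_pi_norm g b
    · simp

/-! ### Estimates in `SU(2)` -/

section SU2

open scoped Matrix.Norms.L2Operator

theorem norm_entry_le (M : Mat2) (i j : Fin 2) : ‖M i j‖ ≤ ‖M‖ := by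
  have h := Matrix.l2_opNorm_mulVec M (EuclideanSpace.single j (1 : ℂ))
  have h2 : ‖(WithLp.toLp 2 (M *ᵥ (EuclideanSpace.single j (1 : ℂ)).ofLp) :
      EuclideanSpace ℂ (Fin 2)) i‖ ≤ _ := (PiLp.norm_apply_le _ i).trans h
  simpa using h2

theorem norm_le_one_of_mem_unitary {U : Mat2} (hU : U ∈ unitary Mat2) : ‖U‖ ≤ 1 :=
  CStarRing.norm_of_mem_unitary hU |>.le

theorem norm_pauli_le (k : Fin 3) : ‖pauli k‖ ≤ 1 := by
  refine norm_le_one_of_mem_unitary ?_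
  refine (Matrix.mem_unitaryGroup_iff (A := pauli k)).2 ?_
  ext i j
  fin_cases k <;> fin_cases i <;> fin_cases j <;>
    simp [pauli, Matrix.mul_apply, Matrix.star_apply]

theorem pauliVec_add (M N : Mat2) : pauliVec (M + N) = pauliVec M + pauliVec N := by
  ext k
  simp [pauliVec, add_mul, Matrix.trace_add, add_div]

theorem pauliVec_sub (M N : Mat2) : pauliVec (M - N) = pauliVec M - pauliVec N := by
  ext k
  simp [pauliVec, sub_mul, Matrix.trace_sub, sub_div]

theorem norm_pauliVec_le (M : Mat2) : ‖pauliVec M‖ ≤ 2 * ‖M‖ := by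
  have h : ∀ k, |pauliVec M k| ≤ ‖M‖ := by
    intro k
    have h1 : ∀ i, ‖(M * pauli k) i i‖ ≤ ‖M‖ := fun i =>
      (norm_entry_le _ i i).trans ((norm_mul_le _ _).trans
        (mul_le_of_le_one_right (norm_nonneg _) (norm_pauli_le k)))
    have h2 : ‖Matrix.trace (M * pauli k)‖ ≤ 2 * ‖M‖ := by
      rw [Matrix.trace_fin_two]
      refine (norm_add_le _ _).trans ?_
      linarith [h1 0, h1 1]
    have h3 := (Complex.abs_im_le_norm _).trans h2
    change |(Matrix.trace (M * pauli k)).im / 2| ≤ ‖M‖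
    rw [abs_div, abs_two]
    linarith
  refine abs_le_of_sq_le_sq' ?_ (by positivity) |>.2
  rw [EuclideanSpace.norm_sq_eq, Fin.sum_univ_three]
  have h' : ∀ k, ‖pauliVec M k‖ ^ 2 ≤ ‖M‖ ^ 2 := fun k => by
    rw [Real.norm_eq_abs]
    have := h k
    gcongr
  nlinarith [h' 0, h' 1, h' 2, sq_nonneg ‖M‖]

theorem quat_sub (p q : ℝ) (v w : Vec) : quat p v - quat q w = quat (p - q) (v - w) := by
  simp only [quat, PiLp.sub_apply, Complex.ofReal_sub, sub_smul, Finset.sum_sub_distrib, smul_sub]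
  abel

theorem norm_quat_le (p : ℝ) (v : Vec) : ‖quat p v‖ ≤ |p| + 3 * ‖v‖ := by
  have h1 : ‖(1 : Mat2)‖ ≤ 1 := norm_le_one_of_mem_unitary (one_mem _)
  refine (norm_add_le _ _).trans (add_le_add ?_ ?_)
  · rw [norm_smul, Complex.norm_real, Real.norm_eq_abs]
    exact mul_le_of_le_one_right (abs_nonneg _) h1
  · rw [norm_smul, Complex.norm_I, one_mul]
    refine (norm_sum_le_of_le Finset.univ (n := fun _ => ‖v‖) fun k _ => ?_).trans (by simp)
    rw [norm_smul, Complex.norm_real]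
    exact (mul_le_of_le_one_right (norm_nonneg _) (norm_pauli_le k)).trans (PiLp.norm_apply_le v k)

/-- For `p = q = 1` the linear part is `v - w`, the lattice gradient that the remainder subtracts.
-/
theorem pauliVec_quat_mul (p q : ℝ) (v w : Vec) :
    pauliVec (quat p v * (quat q w)ᴴ) = q • v - p • w + cross v w := by
  ext k
  fin_cases k <;>
    simp [pauliVec, quat, pauli, cross, cross_apply, Fin.sum_univ_three, Matrix.trace,
      Matrix.mul_apply] <;> ring

theorem norm_cross_le (v w : Vec) : ‖cross v w‖ ≤ ‖v‖ * ‖w‖ := by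
  refine abs_le_of_sq_le_sq' ?_ (by positivity) |>.2
  rw [mul_pow, EuclideanSpace.norm_sq_eq, EuclideanSpace.norm_sq_eq, EuclideanSpace.norm_sq_eq]
  simp only [Fin.sum_univ_three, cross, cross_apply, Real.norm_eq_abs, sq_abs,
    Matrix.cons_val_zero, Matrix.cons_val_one, Matrix.cons_val]
  nlinarith [sq_nonneg (v 0 * w 0 + v 1 * w 1 + v 2 * w 2)]

theorem cross_sub_left (u v w : Vec) : cross (u - v) w = cross u w - cross v w := by
  simp [cross]

theorem cross_sub_right (u v w : Vec) : cross u (v - w) = cross u v - cross u w := by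
  simp [cross]

theorem half_le_zeroPart {v : Vec} (hv : ‖v‖ ≤ 1 / 2) : 1 / 2 ≤ zeroPart v := by
  refine Real.le_sqrt_of_sq_le ?_
  nlinarith [norm_nonneg v]

theorem zeroPart_sq {v : Vec} (hv : ‖v‖ ≤ 1 / 2) : zeroPart v ^ 2 = 1 - ‖v‖ ^ 2 :=
  Real.sq_sqrt (by nlinarith [norm_nonneg v])

theorem zeroPart_zero : zeroPart 0 = 1 := by simp [zeroPart]

theorem abs_zeroPart_sub_le {v w : Vec} (hv : ‖v‖ ≤ 1 / 2) (hw : ‖w‖ ≤ 1 / 2) :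
    |zeroPart v - zeroPart w| ≤ ‖v - w‖ := by
  have h1 := half_le_zeroPart hv
  have h2 := half_le_zeroPart hw
  have h3 := zeroPart_sq hv
  have h4 := zeroPart_sq hw
  -- Difference of squares: both sides are `|‖v‖² - ‖w‖²|`. The sum of zero parts is at least 1 and
  -- the sum of norms at most 1.
  have h5 : |zeroPart v - zeroPart w| * (zeroPart v + zeroPart w)
      = |‖v‖ - ‖w‖| * (‖v‖ + ‖w‖) := by
    rw [← abs_of_nonneg (show 0 ≤ zeroPart v + zeroPart w by linarith),
      ← abs_of_nonneg (show 0 ≤ ‖v‖ + ‖w‖ by positivity), ← abs_mul, ← abs_mul, ← abs_neg]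
    congr 1
    linarith
  have h6 := abs_norm_sub_norm_le v w
  have h7 := abs_nonneg (zeroPart v - zeroPart w)
  have h8 := abs_nonneg (‖v‖ - ‖w‖)
  nlinarith

theorem abs_zeroPart_sub_one_le {v : Vec} (hv : ‖v‖ ≤ 1 / 2) : |zeroPart v - 1| ≤ ‖v‖ := by
  have := abs_zeroPart_sub_le hv (w := 0) (by simp)
  rwa [zeroPart_zero, sub_zero] at this

theorem bracket_zero : bracket 0 = 1 := by
  simp [bracket, quat, zeroPart_zero]

theorem norm_bracket_sub_le {v w : Vec} (hv : ‖v‖ ≤ 1 / 2) (hw : ‖w‖ ≤ 1 / 2) :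
    ‖bracket v - bracket w‖ ≤ 4 * ‖v - w‖ := by
  rw [bracket, bracket, quat_sub]
  refine (norm_quat_le _ _).trans ?_
  linarith [abs_zeroPart_sub_le hv hw]

theorem norm_bracket_le {v : Vec} (hv : ‖v‖ ≤ 1 / 2) : ‖bracket v‖ ≤ 1 :=
  norm_le_one_of_mem_unitary
    (Matrix.mem_specialUnitaryGroup_iff.1 (bracket_mem_SU2 v (by linarith))).1

theorem norm_bracket_sub_one_le {v : Vec} (hv : ‖v‖ ≤ 1 / 2) : ‖bracket v - 1‖ ≤ 4 * ‖v‖ := by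
  have := norm_bracket_sub_le hv (w := 0) (by simp)
  rwa [bracket_zero, sub_zero] at this

/-- The bond variable of the coarse configuration, lifted to the fine lattice. -/
noncomputable def coarseBond {n L : ℕ} (V : CSite n L → SU2) (b : Bond n) : Mat2 :=
  (V (label n L b.1.1) : Mat2) * (V (label n L b.1.2) : Mat2)ᴴ

theorem norm_coarseBond_le {n L : ℕ} (V : CSite n L → SU2) (b : Bond n) :
    ‖coarseBond V b‖ ≤ 1 := by
  refine norm_le_one_of_mem_unitary (mul_mem ?_ (Unitary.star_mem ?_))
  · exact (Matrix.mem_specialUnitaryGroup_iff.1 (V (label n L b.1.1)).2).1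
  · exact (Matrix.mem_specialUnitaryGroup_iff.1 (V (label n L b.1.2)).2).1

theorem norm_coarseBond_sub_one_le {n L : ℕ} {ε₁ : ℝ} (hε₁ : 0 ≤ ε₁) {V : CSite n L → SU2}
    (hV : CoarseSmallField ε₁ V) (b : Bond n) : ‖coarseBond V b - 1‖ ≤ ε₁ := by
  rcases label_bond (L := L) b with h | ⟨b', hb'⟩
  · have hU : (V (label n L b.1.2) : Mat2) * (V (label n L b.1.2) : Mat2)ᴴ = 1 :=
      Matrix.mem_unitaryGroup_iff.1
        (Matrix.mem_specialUnitaryGroup_iff.1 (V (label n L b.1.2)).2).1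
    rw [coarseBond, h, hU, sub_self, norm_zero]
    exact hε₁
  · have := hV b'
    rwa [hb'] at this

theorem norm_mul_mul_sub_le {X Y Z : Mat2} (hY : ‖Y‖ ≤ 1) (hZ : ‖Z‖ ≤ 1) :
    ‖X * Y * Z - 1‖ ≤ ‖X - 1‖ + ‖Y - 1‖ + ‖Z - 1‖ := by
  have e : X * Y * Z - 1 = (X - 1) * Y * Z + (Y - 1) * Z + (Z - 1) := by noncomm_ring
  rw [e]
  refine (norm_add₃_le).trans ?_
  gcongr
  · refine (norm_mul_le _ _).trans ((mul_le_of_le_one_right (norm_nonneg _) hZ).trans ?_)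
    exact (norm_mul_le _ _).trans (mul_le_of_le_one_right (norm_nonneg _) hY)
  · exact (norm_mul_le _ _).trans (mul_le_of_le_one_right (norm_nonneg _) hZ)

theorem norm_plaq_sub_one_le {n L : ℕ} {ε₁ s : ℝ} (hε₁ : 0 ≤ ε₁) {V : CSite n L → SU2}
    (hV : CoarseSmallField ε₁ V) {A : VField n} (hs : s ≤ 1 / 2) (hA : ‖A‖ ≤ s) (b : Bond n) :
    opNorm (plaq V A b - 1) ≤ 8 * s + ε₁ := by
  have hx : ∀ x, ‖A x‖ ≤ s := fun x => (norm_le_pi_norm A x).trans hA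
  have h1 := norm_bracket_sub_one_le ((hx b.1.1).trans hs)
  have h2 := norm_bracket_sub_one_le ((hx b.1.2).trans hs)
  have h3 : ‖(bracket (A b.1.2))ᴴ - 1‖ = ‖bracket (A b.1.2) - 1‖ := by
    rw [← Matrix.l2_opNorm_conjTranspose (bracket (A b.1.2) - 1), Matrix.conjTranspose_sub,
      Matrix.conjTranspose_one]
  have h4 := norm_mul_mul_sub_le (X := bracket (A b.1.1)) (norm_coarseBond_le V b)
    (Z := (bracket (A b.1.2))ᴴ)
    (by rw [Matrix.l2_opNorm_conjTranspose]; exact norm_bracket_le ((hx b.1.2).trans hs))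
  have h5 := norm_coarseBond_sub_one_le hε₁ hV b
  rw [h3] at h4
  refine h4.trans ?_
  linarith [hx b.1.1, hx b.1.2]

/-- The quadratic part of the remainder. -/
noncomputable def quadPart (v w : Vec) : Vec :=
  (zeroPart w - 1) • v - (zeroPart v - 1) • w + cross v w

/-- Write the coarse bond variable as `1 + E`. The `1` gives the pure product of brackets, whose
linear part cancels `∂A`; `E` is of size `ε₁`. -/
theorem remainder_eq {n L : ℕ} (V : CSite n L → SU2) (A : VField n) (b : Bond n) :
    remainder V A b = quadPart (A b.1.1) (A b.1.2)
      + pauliVec (bracket (A b.1.1) * (coarseBond V b - 1) * (bracket (A b.1.2))ᴴ) := by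
  have e : plaq V A b = bracket (A b.1.1) * (bracket (A b.1.2))ᴴ
      + bracket (A b.1.1) * (coarseBond V b - 1) * (bracket (A b.1.2))ᴴ := by
    change bracket (A b.1.1) * coarseBond V b * (bracket (A b.1.2))ᴴ = _
    noncomm_ring
  rw [remainder, e, pauliVec_add, grad_apply]
  simp only [bracket]
  rw [pauliVec_quat_mul, quadPart, sub_smul, sub_smul, one_smul, one_smul]
  abel

/-- Each of the three terms is a product of two factors of size `s`, Lipschitz in the fields, and so
contributes `2sd`. -/
theorem norm_quadPart_sub_le {s d : ℝ} (hs : s ≤ 1 / 2) {v w v' w' : Vec} (hv : ‖v‖ ≤ s)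
    (hw : ‖w‖ ≤ s) (hv' : ‖v'‖ ≤ s) (hw' : ‖w'‖ ≤ s) (hvd : ‖v - v'‖ ≤ d) (hwd : ‖w - w'‖ ≤ d) :
    ‖quadPart v w - quadPart v' w'‖ ≤ 6 * s * d := by
  have hs0 : 0 ≤ s := (norm_nonneg v).trans hv
  have hd0 : 0 ≤ d := (norm_nonneg _).trans hvd
  have key : ∀ a b a' b' : Vec, ‖a‖ ≤ s → ‖b‖ ≤ s → ‖a'‖ ≤ s → ‖b'‖ ≤ s → ‖a - a'‖ ≤ d →
      ‖b - b'‖ ≤ d → ‖(zeroPart b - 1) • a - (zeroPart b' - 1) • a'‖ ≤ 2 * s * d := by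
    intro a b a' b' ha hb ha' hb' had hbd
    have e : (zeroPart b - 1) • a - (zeroPart b' - 1) • a'
        = (zeroPart b - 1) • (a - a') + (zeroPart b - zeroPart b') • a' := by module
    rw [e]
    refine (norm_add_le _ _).trans ?_
    rw [norm_smul, norm_smul, Real.norm_eq_abs, Real.norm_eq_abs]
    have h1 := (abs_zeroPart_sub_one_le (hb.trans hs)).trans hb
    have h2 := (abs_zeroPart_sub_le (hb.trans hs) (hb'.trans hs)).trans hbd
    calc _ ≤ s * d + d * s := by gcongr
      _ = _ := by ring
  have hc : ‖cross v w - cross v' w'‖ ≤ 2 * s * d := by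
    have e : cross v w - cross v' w' = cross (v - v') w + cross v' (w - w') := by
      rw [cross_sub_left, cross_sub_right]; abel
    rw [e]
    refine (norm_add_le _ _).trans ?_
    calc _ ≤ ‖v - v'‖ * ‖w‖ + ‖v'‖ * ‖w - w'‖ :=
          add_le_add (norm_cross_le _ _) (norm_cross_le _ _)
      _ ≤ d * s + s * d := by gcongr
      _ = _ := by ring
  have h1 := key v w v' w' hv hw hv' hw' hvd hwd
  have h2 := key w v w' v' hw hv hw' hv' hwd hvd
  have e : quadPart v w - quadPart v' w'
      = ((zeroPart w - 1) • v - (zeroPart w' - 1) • v')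
        - ((zeroPart v - 1) • w - (zeroPart v' - 1) • w') + (cross v w - cross v' w') := by
    rw [quadPart, quadPart]; abel
  rw [e]
  refine (norm_add_le _ _).trans ?_
  have := norm_sub_le ((zeroPart w - 1) • v - (zeroPart w' - 1) • v')
    ((zeroPart v - 1) • w - (zeroPart v' - 1) • w')
  linarith

/-- The term `6s` comes from the quadratic part. The term `16ε₁` is `2 · (4 + 4)ε₁`: the bound for
`pauliVec` times the Lipschitz constants of the two brackets. -/
theorem norm_remainder_sub_le {n L : ℕ} {ε₁ s : ℝ} (hε₁ : 0 ≤ ε₁) {V : CSite n L → SU2}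
    (hV : CoarseSmallField ε₁ V) (hs : s ≤ 1 / 2) {A A' : VField n} (hA : ‖A‖ ≤ s)
    (hA' : ‖A'‖ ≤ s) :
    ‖remainder V A - remainder V A'‖ ≤ (6 * s + 16 * ε₁) * ‖A - A'‖ := by
  have hs0 : 0 ≤ s := (norm_nonneg _).trans hA
  refine (pi_norm_le_iff_of_nonneg (by positivity)).2 fun b => ?_
  have hx : ∀ x, ‖A x‖ ≤ s := fun x => (norm_le_pi_norm A x).trans hA
  have hx' : ∀ x, ‖A' x‖ ≤ s := fun x => (norm_le_pi_norm A' x).trans hA'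
  have hd : ∀ x, ‖A x - A' x‖ ≤ ‖A - A'‖ := fun x => norm_le_pi_norm (A - A') x
  rw [Pi.sub_apply, remainder_eq, remainder_eq, add_sub_add_comm, ← pauliVec_sub]
  set E := coarseBond V b - 1 with hEdef
  have hE : ‖E‖ ≤ ε₁ := norm_coarseBond_sub_one_le hε₁ hV b
  have e : bracket (A b.1.1) * E * (bracket (A b.1.2))ᴴ
      - bracket (A' b.1.1) * E * (bracket (A' b.1.2))ᴴ
      = (bracket (A b.1.1) - bracket (A' b.1.1)) * E * (bracket (A b.1.2))ᴴ
        + bracket (A' b.1.1) * E * (bracket (A b.1.2) - bracket (A' b.1.2))ᴴ := by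
    rw [Matrix.conjTranspose_sub]
    noncomm_ring
  have h1 := (norm_bracket_sub_le ((hx b.1.1).trans hs) ((hx' b.1.1).trans hs)).trans
    (mul_le_mul_of_nonneg_left (hd b.1.1) (by norm_num))
  have h2 := (norm_bracket_sub_le ((hx b.1.2).trans hs) ((hx' b.1.2).trans hs)).trans
    (mul_le_mul_of_nonneg_left (hd b.1.2) (by norm_num))
  have h3 := norm_bracket_le ((hx b.1.2).trans hs)
  have h4 := norm_bracket_le ((hx' b.1.1).trans hs)
  have h5 : ‖bracket (A b.1.1) * E * (bracket (A b.1.2))ᴴ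
      - bracket (A' b.1.1) * E * (bracket (A' b.1.2))ᴴ‖
      ≤ 4 * ‖A - A'‖ * ε₁ * 1 + 1 * ε₁ * (4 * ‖A - A'‖) := by
    rw [e]
    refine (norm_add_le _ _).trans (add_le_add ?_ ?_)
    · refine (norm_mul_le _ _).trans ?_
      rw [Matrix.l2_opNorm_conjTranspose]
      have := norm_mul_le (bracket (A b.1.1) - bracket (A' b.1.1)) E
      gcongr
      exact this.trans (by gcongr)
    · refine (norm_mul_le _ _).trans ?_
      rw [Matrix.l2_opNorm_conjTranspose]
      have := norm_mul_le (bracket (A' b.1.1)) E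
      gcongr
      exact this.trans (by gcongr)
  have h6 := norm_quadPart_sub_le hs (hx b.1.1) (hx b.1.2) (hx' b.1.1) (hx' b.1.2)
    (hd b.1.1) (hd b.1.2)
  refine (norm_add_le _ _).trans ?_
  have h7 := norm_pauliVec_le (bracket (A b.1.1) * E * (bracket (A b.1.2))ᴴ
      - bracket (A' b.1.1) * E * (bracket (A' b.1.2))ᴴ)
  linarith

theorem norm_remainder_zero_le {n L : ℕ} {ε₁ : ℝ} (hε₁ : 0 ≤ ε₁) {V : CSite n L → SU2}
    (hV : CoarseSmallField ε₁ V) : ‖remainder V 0‖ ≤ 2 * ε₁ := by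
  refine (pi_norm_le_iff_of_nonneg (by positivity)).2 fun b => ?_
  rw [remainder_eq]
  have h0 : quadPart 0 0 = 0 := by simp [quadPart, cross]
  simp only [Pi.zero_apply, h0, bracket_zero, Matrix.conjTranspose_one, one_mul, mul_one, zero_add]
  refine (norm_pauliVec_le _).trans ?_
  linarith [norm_coarseBond_sub_one_le hε₁ hV b]

theorem norm_remainder_le {n L : ℕ} {ε₁ s : ℝ} (hε₁ : 0 ≤ ε₁) {V : CSite n L → SU2}
    (hV : CoarseSmallField ε₁ V) (hs : s ≤ 1 / 2) {A : VField n} (hA : ‖A‖ ≤ s) :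
    ‖remainder V A‖ ≤ (6 * s + 16 * ε₁) * s + 2 * ε₁ := by
  have hs0 : 0 ≤ s := (norm_nonneg _).trans hA
  have h1 := norm_remainder_sub_le hε₁ hV hs hA (A' := 0) (by simpa)
  have h2 := norm_remainder_zero_le hε₁ hV
  rw [sub_zero] at h1
  have h3 := norm_le_norm_sub_add (remainder V A) (remainder V 0)
  have h4 : (6 * s + 16 * ε₁) * ‖A‖ ≤ (6 * s + 16 * ε₁) * s := by gcongr
  linarith

end SU2

/-! ### The rotation `R_A*` -/

theorem norm_rotAdj_sub_le {n : ℕ} {A A' : VField n} (hA : ‖A‖ ≤ 1 / 2) (hA' : ‖A'‖ ≤ 1 / 2)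
    (v : VField n) : ‖rotAdj A v - rotAdj A' v‖ ≤ 2 * ‖A - A'‖ * ‖v‖ := by
  refine (pi_norm_le_iff_of_nonneg (by positivity)).2 fun x => ?_
  have hd : ‖A x - A' x‖ ≤ ‖A - A'‖ := norm_le_pi_norm (A - A') x
  have hz := abs_zeroPart_sub_le ((norm_le_pi_norm A x).trans hA)
    ((norm_le_pi_norm A' x).trans hA')
  have hv := norm_le_pi_norm v x
  have e : (rotAdj A v - rotAdj A' v) x
      = (zeroPart (A x) - zeroPart (A' x)) • v x - cross (A x - A' x) (v x) := by
    rw [cross_sub_left, sub_smul]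
    simp only [rotAdj, Pi.sub_apply, LinearMap.coe_mk, AddHom.coe_mk]
    abel
  rw [e]
  refine (norm_sub_le _ _).trans ?_
  rw [norm_smul, Real.norm_eq_abs]
  have h1 : |zeroPart (A x) - zeroPart (A' x)| * ‖v x‖ ≤ ‖A - A'‖ * ‖v‖ :=
    mul_le_mul (hz.trans hd) hv (norm_nonneg _) (norm_nonneg _)
  have h2 : ‖cross (A x - A' x) (v x)‖ ≤ ‖A - A'‖ * ‖v‖ :=
    (norm_cross_le _ _).trans (mul_le_mul hd hv (norm_nonneg _) (norm_nonneg _))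
  linarith

theorem rotAdj_zero {n : ℕ} (v : VField n) : rotAdj 0 v = v := by
  funext x
  simp [rotAdj, zeroPart_zero, cross]

theorem norm_rotAdj_le {n : ℕ} {A : VField n} (hA : ‖A‖ ≤ 1 / 2) (v : VField n) :
    ‖rotAdj A v‖ ≤ 2 * ‖v‖ := by
  have h := norm_rotAdj_sub_le hA (A' := 0) (by simp) v
  rw [rotAdj_zero, sub_zero] at h
  have h2 := norm_le_norm_sub_add (rotAdj A v) v
  have h3 : 2 * ‖A‖ * ‖v‖ ≤ 1 * ‖v‖ := by gcongr; linarith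
  linarith

/-! ### The fixed-point map -/

/-- Sup norm bounds for `G(Ω)` and `[Q G(Ω) Q*]⁻¹`. -/
structure LinearBounds (n L : ℕ) (K C : ℝ) : Prop where
  pos_L : 0 < L
  nonneg_green : 0 ≤ K
  nonneg_coarse : 0 ≤ C
  hamiltonian_lower : ∀ f : VField n, ‖f‖ ≤ K * ‖hamiltonian n L f‖
  coarse_lower : ∀ (f : VField n) (l : CField n L),
    hamiltonian n L f = avgAdj n L l → ‖l‖ ≤ C * ‖avg n L f‖

variable {n L : ℕ} {K C : ℝ}

theorem LinearBounds.isUnit_hamiltonian (h : LinearBounds n L K C) : IsUnit (hamiltonian n L) :=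
  isUnit_of_norm_le h.hamiltonian_lower

theorem LinearBounds.norm_green_le (h : LinearBounds n L K C) (g : VField n) :
    ‖green n L g‖ ≤ K * ‖g‖ :=
  norm_ringInverse_le h.hamiltonian_lower g

theorem coarseOp_apply (A : VField n) (l : CField n L) :
    coarseOp n L A l = avg n L (green n L (rotAdj A (avgAdj n L l))) := rfl

theorem LinearBounds.norm_coarseOp_sub_le (h : LinearBounds n L K C) {A A' : VField n}
    (hA : ‖A‖ ≤ 1 / 2) (hA' : ‖A'‖ ≤ 1 / 2) (l : CField n L) :
    ‖coarseOp n L A l - coarseOp n L A' l‖ ≤ K * (2 * ‖A - A'‖ * ‖l‖) := by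
  have hK := h.nonneg_green
  rw [coarseOp_apply, coarseOp_apply, ← map_sub, ← map_sub]
  refine (norm_avg_le h.pos_L _).trans ((h.norm_green_le _).trans ?_)
  gcongr
  refine (norm_rotAdj_sub_le hA hA' _).trans ?_
  gcongr
  exact norm_avgAdj_le l

/-- At `A = 0` the operator is `QGQ*`, bounded below by `coarse_lower`. The change to `A` costs
`2CK‖A‖‖l‖ ≤ ‖l‖/2`, which is absorbed. -/
theorem LinearBounds.norm_le_coarseOp (h : LinearBounds n L K C) {A : VField n}
    (hA : ‖A‖ ≤ 1 / 2) (hsmall : 4 * C * K * ‖A‖ ≤ 1) (l : CField n L) :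
    ‖l‖ ≤ 2 * C * ‖coarseOp n L A l‖ := by
  have hC := h.nonneg_coarse
  have h1 := h.coarse_lower (green n L (avgAdj n L l)) l
    (apply_ringInverse h.isUnit_hamiltonian _)
  have h0 : avg n L (green n L (avgAdj n L l)) = coarseOp n L 0 l := by
    rw [coarseOp_apply, rotAdj_zero]
  rw [h0] at h1
  have h2 := h.norm_coarseOp_sub_le (A := 0) (A' := A) (by simp) hA l
  rw [zero_sub, norm_neg] at h2
  have h3 := norm_le_norm_sub_add (coarseOp n L 0 l) (coarseOp n L A l)
  have h4 : ‖l‖ ≤ C * (K * (2 * ‖A‖ * ‖l‖) + ‖coarseOp n L A l‖) :=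
    h1.trans (mul_le_mul_of_nonneg_left (h3.trans (by linarith)) hC)
  have h5 : 4 * C * K * ‖A‖ * ‖l‖ ≤ 1 * ‖l‖ := mul_le_mul_of_nonneg_right hsmall (norm_nonneg _)
  linarith

theorem LinearBounds.isUnit_coarseOp (h : LinearBounds n L K C) {A : VField n}
    (hA : ‖A‖ ≤ 1 / 2) (hsmall : 4 * C * K * ‖A‖ ≤ 1) : IsUnit (coarseOp n L A) :=
  isUnit_of_norm_le (h.norm_le_coarseOp hA hsmall)

theorem projOp_apply (A g : VField n) :
    projOp n L A g
      = green n L (rotAdj A (avgAdj n L (Ring.inverse (coarseOp n L A) (avg n L g)))) := rfl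

/-- `Q M_A = D_A D_A⁻¹ Q = Q`, the identity that gives `Q T(A) = 0`. -/
theorem avg_projOp {A : VField n} (hA : IsUnit (coarseOp n L A)) (g : VField n) :
    avg n L (projOp n L A g) = avg n L g := by
  rw [projOp_apply, ← coarseOp_apply, apply_ringInverse hA]

theorem fixMap_apply (V : CSite n L → SU2) (A : VField n) :
    fixMap V A = projOp n L A (green n L (gradAdj n (remainder V A)))
      - green n L (gradAdj n (remainder V A)) := rfl

theorem isCriticalSolution_iff (V : CSite n L → SU2) (A : VField n) :
    IsCriticalSolution V A ↔ fixMap V A = A := eq_comm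

theorem avg_fixMap (V : CSite n L → SU2) {A : VField n} (hA : IsUnit (coarseOp n L A)) :
    avg n L (fixMap V A) = 0 := by
  rw [fixMap_apply, map_sub, avg_projOp hA, sub_self]

theorem LinearBounds.norm_projOp_le (h : LinearBounds n L K C) {A : VField n}
    (hA : ‖A‖ ≤ 1 / 2) (hsmall : 4 * C * K * ‖A‖ ≤ 1) (g : VField n) :
    ‖projOp n L A g‖ ≤ 4 * K * C * ‖g‖ := by
  have hK := h.nonneg_green
  have hC := h.nonneg_coarse
  have hp := norm_ringInverse_le (h.norm_le_coarseOp hA hsmall) (avg n L g)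
  rw [projOp_apply]
  calc _ ≤ K * (2 * (2 * C * ‖g‖)) := by
        refine (h.norm_green_le _).trans ?_
        gcongr
        refine (norm_rotAdj_le hA _).trans ?_
        gcongr
        refine (norm_avgAdj_le _).trans (hp.trans ?_)
        gcongr
        exact norm_avg_le h.pos_L g
    _ = _ := by ring

theorem LinearBounds.norm_projOp_sub_le (h : LinearBounds n L K C) {A A' : VField n}
    (hA : ‖A‖ ≤ 1 / 2) (hsA : 4 * C * K * ‖A‖ ≤ 1) (hA' : ‖A'‖ ≤ 1 / 2)
    (hsA' : 4 * C * K * ‖A'‖ ≤ 1) (g : VField n) :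
    ‖projOp n L A g - projOp n L A' g‖
      ≤ (4 * K * C + (4 * K * C) ^ 2) * ‖A - A'‖ * ‖g‖ := by
  have hK := h.nonneg_green
  have hC := h.nonneg_coarse
  rw [projOp_apply, projOp_apply]
  set p := Ring.inverse (coarseOp n L A) (avg n L g) with hp
  set p' := Ring.inverse (coarseOp n L A') (avg n L g) with hp'
  have hpn : ‖p‖ ≤ 2 * C * ‖g‖ := by
    refine (norm_ringInverse_le (h.norm_le_coarseOp hA hsA) (avg n L g)).trans ?_
    gcongr
    exact norm_avg_le h.pos_L g
  have hpp : ‖p - p'‖ ≤ 2 * C * (K * (2 * ‖A - A'‖ * (2 * C * ‖g‖))) := by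
    -- Resolvent identity: `D_A p` and `D_{A'} p'` both equal `Qg`.
    have e : coarseOp n L A' (p - p') = coarseOp n L A' p - coarseOp n L A p := by
      rw [map_sub, hp', apply_ringInverse (h.isUnit_coarseOp hA' hsA'), hp,
        apply_ringInverse (h.isUnit_coarseOp hA hsA)]
    refine (h.norm_le_coarseOp hA' hsA' _).trans ?_
    rw [e]
    gcongr
    refine (h.norm_coarseOp_sub_le hA' hA p).trans ?_
    rw [norm_sub_rev A' A]
    gcongr
  have e : green n L (rotAdj A (avgAdj n L p)) - green n L (rotAdj A' (avgAdj n L p'))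
      = green n L (rotAdj A (avgAdj n L p) - rotAdj A' (avgAdj n L p))
        + green n L (rotAdj A' (avgAdj n L (p - p'))) := by
    simp only [map_sub]
    abel
  rw [e]
  calc _ ≤ K * (2 * ‖A - A'‖ * (2 * C * ‖g‖))
        + K * (2 * (2 * C * (K * (2 * ‖A - A'‖ * (2 * C * ‖g‖))))) := by
        refine (norm_add_le _ _).trans (add_le_add ?_ ?_)
        · refine (h.norm_green_le _).trans ?_
          gcongr
          refine (norm_rotAdj_sub_le hA hA' _).trans ?_
          gcongr
          exact (norm_avgAdj_le p).trans hpn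
        · refine (h.norm_green_le _).trans ?_
          gcongr
          refine (norm_rotAdj_le hA' _).trans ?_
          gcongr
          exact (norm_avgAdj_le _).trans hpp
    _ = _ := by ring

theorem LinearBounds.norm_green_gradAdj_le (h : LinearBounds n L K C) (r : BField n) :
    ‖green n L (gradAdj n r)‖ ≤ 4 * K * ‖r‖ := by
  have hK := h.nonneg_green
  calc _ ≤ K * (4 * ‖r‖) := by
        refine (h.norm_green_le _).trans ?_
        gcongr
        exact norm_gradAdj_le r
    _ = _ := by ring

theorem LinearBounds.norm_fixMap_le (h : LinearBounds n L K C) (V : CSite n L → SU2)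
    {A : VField n} (hA : ‖A‖ ≤ 1 / 2) (hsmall : 4 * C * K * ‖A‖ ≤ 1) :
    ‖fixMap V A‖ ≤ (4 * K * C + 1) * (4 * K) * ‖remainder V A‖ := by
  have hK := h.nonneg_green
  have hC := h.nonneg_coarse
  rw [fixMap_apply]
  have h1 := h.norm_green_gradAdj_le (remainder V A)
  set g := green n L (gradAdj n (remainder V A))
  calc _ ≤ 4 * K * C * ‖g‖ + ‖g‖ :=
        (norm_sub_le _ _).trans (add_le_add (h.norm_projOp_le hA hsmall g) le_rfl)
    _ = (4 * K * C + 1) * ‖g‖ := by ring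
    _ ≤ (4 * K * C + 1) * (4 * K * ‖remainder V A‖) := by gcongr
    _ = _ := by ring

/-- Vary first the projection at fixed remainder, then the remainder. The first term is small
because the remainder itself is, the second because the remainder has a small Lipschitz constant. -/
theorem LinearBounds.norm_fixMap_sub_le (h : LinearBounds n L K C) (V : CSite n L → SU2)
    {A A' : VField n} (hA : ‖A‖ ≤ 1 / 2) (hsA : 4 * C * K * ‖A‖ ≤ 1) (hA' : ‖A'‖ ≤ 1 / 2)
    (hsA' : 4 * C * K * ‖A'‖ ≤ 1) :
    ‖fixMap V A - fixMap V A'‖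
      ≤ (4 * K * C + (4 * K * C) ^ 2) * (4 * K) * ‖remainder V A‖ * ‖A - A'‖
        + (4 * K * C + 1) * (4 * K) * ‖remainder V A - remainder V A'‖ := by
  have hK := h.nonneg_green
  have hC := h.nonneg_coarse
  rw [fixMap_apply, fixMap_apply]
  have h1 := h.norm_green_gradAdj_le (remainder V A)
  have h2 := h.norm_green_gradAdj_le (remainder V A - remainder V A')
  rw [map_sub, map_sub] at h2
  set g := green n L (gradAdj n (remainder V A))
  set g' := green n L (gradAdj n (remainder V A'))
  have e : projOp n L A g - g - (projOp n L A' g' - g')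
      = (projOp n L A g - projOp n L A' g) + (projOp n L A' (g - g') - (g - g')) := by
    rw [map_sub]
    abel
  rw [e]
  calc _ ≤ (4 * K * C + (4 * K * C) ^ 2) * ‖A - A'‖ * ‖g‖
        + (4 * K * C * ‖g - g'‖ + ‖g - g'‖) :=
        (norm_add_le _ _).trans (add_le_add (h.norm_projOp_sub_le hA hsA hA' hsA' g)
          ((norm_sub_le _ _).trans (add_le_add (h.norm_projOp_le hA' hsA' _) le_rfl)))
    _ = (4 * K * C + (4 * K * C) ^ 2) * ‖A - A'‖ * ‖g‖ + (4 * K * C + 1) * ‖g - g'‖ := by ring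
    _ ≤ (4 * K * C + (4 * K * C) ^ 2) * ‖A - A'‖ * (4 * K * ‖remainder V A‖)
        + (4 * K * C + 1) * (4 * K * ‖remainder V A - remainder V A'‖) := by gcongr
    _ = _ := by ring

theorem exists_linearBounds (hL : 0 < L) :
    ∃ K C : ℝ, 0 ≤ K ∧ 0 ≤ C ∧ ∀ n, LinearBounds n L K C := by
  obtain ⟨K, hK, h1⟩ := exists_hamiltonian_lower hL
  obtain ⟨C, hC, h2⟩ := exists_coarse_lower hL
  exact ⟨K, C, hK.le, hC.le, fun n => ⟨hL, hK.le, hC.le, h1 n, h2 n⟩⟩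

/-- A contraction of a closed ball of a Banach space around the origin has a fixed point in it. -/
theorem exists_fixedPoint_of_contraction {E : Type*} [NormedAddCommGroup E] [CompleteSpace E]
    {T : E → E} {s : ℝ} (hs : 0 ≤ s) (hT : ∀ A, ‖A‖ ≤ s → ‖T A‖ ≤ s)
    (hc : ∀ A A', ‖A‖ ≤ s → ‖A'‖ ≤ s → ‖T A - T A'‖ ≤ 1 / 2 * ‖A - A'‖) :
    ∃ A, ‖A‖ ≤ s ∧ T A = A := by
  have hmaps : Set.MapsTo T (Metric.closedBall 0 s) (Metric.closedBall 0 s) := fun A hA => by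
    rw [mem_closedBall_zero_iff] at hA ⊢
    exact hT A hA
  have hcw : ContractingWith (1 / 2) (hmaps.restrict T _ _) := by
    refine ⟨by rw [← NNReal.coe_lt_coe]; norm_num, LipschitzWith.of_dist_le_mul ?_⟩
    rintro ⟨A, hA⟩ ⟨A', hA'⟩
    have := hc A A' (mem_closedBall_zero_iff.1 hA) (mem_closedBall_zero_iff.1 hA')
    simpa [Subtype.dist_eq, dist_eq_norm] using this
  obtain ⟨A, hA, hfix, -⟩ := hcw.exists_fixedPoint' Metric.isClosed_closedBall.isComplete hmaps
    (x := 0) (Metric.mem_closedBall_self hs) (edist_ne_top _ _)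
  exact ⟨A, mem_closedBall_zero_iff.1 hA, hfix⟩

/-- The hypotheses concern the full ball of radius `s`, which contains `X_ε` and which `T` maps into
`X_ε`. The bound `δ` on the values must be finer than `s`: the bond condition needs `8δ + ε₁ ≤ ε`.
-/
theorem LinearBounds.unique_solvability (h : LinearBounds n L K C) {c ε ε₁ s δ : ℝ}
    {V : CSite n L → SU2} (hε₁ : 0 ≤ ε₁) (hV : CoarseSmallField ε₁ V)
    (hsε : s = 4 * c * (L : ℝ) ^ 2 * ε) (hs0 : 0 ≤ s) (hs : s ≤ 1 / 2) (hsmall : 4 * C * K * s ≤ 1)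
    (hδs : δ ≤ s) (hδε : 8 * δ + ε₁ ≤ ε)
    (hT : ∀ A : VField n, ‖A‖ ≤ s → ‖fixMap V A‖ ≤ δ)
    (hcontr : ∀ A A' : VField n, ‖A‖ ≤ s → ‖A'‖ ≤ s →
      ‖fixMap V A - fixMap V A'‖ ≤ 1 / 2 * ‖A - A'‖) :
    IsUnit (hamiltonian n L) ∧ (∀ A ∈ fieldSpace c V ε, IsUnit (coarseOp n L A)) ∧
      Set.MapsTo (fixMap V) (fieldSpace c V ε) (fieldSpace c V ε) ∧
      (∀ A₁ ∈ fieldSpace c V ε, ∀ A₂ ∈ fieldSpace c V ε,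
        ‖fixMap V A₁ - fixMap V A₂‖ ≤ 1 / 2 * ‖A₁ - A₂‖) ∧
      ∃! A : VField n, A ∈ fieldSpace c V ε ∧ IsCriticalSolution V A := by
  have hK := h.nonneg_green
  have hC := h.nonneg_coarse
  have hunit : ∀ A : VField n, ‖A‖ ≤ s → IsUnit (coarseOp n L A) := fun A hA =>
    h.isUnit_coarseOp (hA.trans hs)
      ((mul_le_mul_of_nonneg_left hA (by positivity)).trans hsmall)
  have hmem : ∀ A ∈ fieldSpace c V ε, ‖A‖ ≤ s := fun A hA =>
    (pi_norm_le_iff_of_nonneg hs0).2 (hsε ▸ hA.1)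
  have hball : ∀ A : VField n, ‖A‖ ≤ s → ‖fixMap V A‖ ≤ s := fun A hA => (hT A hA).trans hδs
  have hmaps : ∀ A : VField n, ‖A‖ ≤ s → fixMap V A ∈ fieldSpace c V ε := fun A hA =>
    ⟨hsε ▸ (pi_norm_le_iff_of_nonneg hs0).1 (hball A hA), avg_fixMap V (hunit A hA), fun b =>
      (norm_plaq_sub_one_le hε₁ hV (hδs.trans hs) (hT A hA) b).trans hδε⟩
  obtain ⟨A, hA, hfix⟩ := exists_fixedPoint_of_contraction hs0 hball hcontr
  refine ⟨h.isUnit_hamiltonian, fun A hA => hunit A (hmem A hA), fun A hA => hmaps A (hmem A hA),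
    fun A₁ h₁ A₂ h₂ => hcontr A₁ A₂ (hmem A₁ h₁) (hmem A₂ h₂), A,
    ⟨by rw [← hfix]; exact hmaps A hA, (isCriticalSolution_iff V A).2 hfix⟩, ?_⟩
  rintro A' ⟨hA', hcrit⟩
  have h1 := hcontr A' A (hmem A' hA') hA
  rw [(isCriticalSolution_iff V A').1 hcrit, hfix] at h1
  have h2 := norm_nonneg (A' - A)
  exact sub_eq_zero.1 (norm_eq_zero.1 (by linarith))

end SigmaModel

/-! ### Choice of the constants -/

theorem mainTheorem9 (L : ℕ) (hL : 1 < L) (hodd : Odd L) (c : ℝ) (hc : 1 ≤ c) :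
    ∃ ε₀ : ℝ, 0 < ε₀ ∧ ε₀ ≤ 1 ∧ ∃ q : ℝ, 0 ≤ q ∧ q < 1 ∧
      ∀ ε ε₁ : ℝ, 0 < ε → ε ≤ ε₀ → 0 < ε₁ → ε₁ ≤ ε ^ 2 →
      ∀ n : ℕ, 1 ≤ n →
      ∀ V : SigmaModel.CSite n L → SigmaModel.SU2, SigmaModel.CoarseSmallField ε₁ V →
        -- the inverses in the definition of the map exist
        IsUnit (SigmaModel.hamiltonian n L) ∧
        (∀ A ∈ SigmaModel.fieldSpace c V ε, IsUnit (SigmaModel.coarseOp n L A)) ∧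
        -- the space is preserved
        Set.MapsTo (SigmaModel.fixMap V) (SigmaModel.fieldSpace c V ε)
          (SigmaModel.fieldSpace c V ε) ∧
        -- contraction in the sup norm
        (∀ A₁ ∈ SigmaModel.fieldSpace c V ε, ∀ A₂ ∈ SigmaModel.fieldSpace c V ε,
          ‖SigmaModel.fixMap V A₁ - SigmaModel.fixMap V A₂‖ ≤ q * ‖A₁ - A₂‖) ∧
        -- unique solvability of the critical-point equation
        ∃! A : SigmaModel.VField n, A ∈ SigmaModel.fieldSpace c V ε ∧
          SigmaModel.IsCriticalSolution V A := by
  open SigmaModel in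
  have hL0 : 0 < L := by omega
  have hL1 : (1 : ℝ) ≤ L := by exact_mod_cast hL.le
  obtain ⟨K, C, hK, hC, hlin⟩ := exists_linearBounds hL0
  obtain ⟨a, ha⟩ : ∃ t : ℝ, t = 4 * c * (L : ℝ) ^ 2 := ⟨_, rfl⟩
  have ha1 : 1 ≤ a := by
    have := one_le_mul_of_one_le_of_one_le hc (one_le_pow₀ hL1 (n := 2))
    linarith
  obtain ⟨b, hb⟩ : ∃ t : ℝ, t = 6 * a + 16 := ⟨_, rfl⟩
  obtain ⟨N, hN⟩ : ∃ t : ℝ, t = (4 * K * C + 1) * (4 * K) * (a * b + 2) := ⟨_, rfl⟩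
  obtain ⟨N', hN'⟩ : ∃ t : ℝ, t = (4 * K * C + (4 * K * C) ^ 2) * (4 * K) * (a * b + 2)
    + (4 * K * C + 1) * (4 * K) * b := ⟨_, rfl⟩
  have hb0 : 0 ≤ b := by linarith
  have hN0 : 0 ≤ N := by rw [hN]; positivity
  have hN'0 : 0 ≤ N' := by rw [hN']; positivity
  have hCKa : 0 ≤ 4 * C * K * a := by positivity
  -- `S` dominates every constant that has to be beaten by `ε`, so `ε ≤ 1/S` yields all smallness
  -- conditions at once. Here `aε` is the radius of the ball, `bε` bounds the Lipschitz constant of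
  -- the remainder, `Nε²` bounds `T(A)`, and `N'ε` is the contraction constant.
  obtain ⟨S, hS⟩ : ∃ t : ℝ, t = 1 + 2 * a + 4 * C * K * a + 9 * N + 2 * N' := ⟨_, rfl⟩
  have hS1 : 1 ≤ S := by linarith
  refine ⟨1 / S, by positivity, by rw [div_le_one] <;> linarith, 1 / 2, by norm_num, by norm_num,
    fun ε ε₁ hε hεS hε₁ hεε n hn V hV => ?_⟩
  have hSε : S * ε ≤ 1 := by
    rwa [le_div_iff₀ (by linarith), mul_comm] at hεS
  have hdom : ∀ t : ℝ, t ≤ S → t * ε ≤ 1 := fun t ht =>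
    (mul_le_mul_of_nonneg_right ht hε.le).trans hSε
  have hε1 : ε ≤ 1 := by simpa using hdom 1 hS1
  have hs : a * ε ≤ 1 / 2 := by linarith [hdom (2 * a) (by linarith)]
  have hs0 : 0 ≤ a * ε := by positivity
  have hNε : N * ε ≤ 1 := hdom N (by linarith)
  have h9 : (8 * N + 1) * ε ≤ 1 := hdom _ (by linarith)
  have hN'ε : N' * ε ≤ 1 / 2 := by linarith [hdom (2 * N') (by linarith)]
  have hsm : 4 * C * K * (a * ε) ≤ 1 := by linarith [hdom (4 * C * K * a) (by linarith)]
  have hεsq : ε ^ 2 ≤ ε := by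
    rw [sq]
    exact mul_le_of_le_one_left hε.le hε1
  have hε₁ε : ε₁ ≤ ε := hεε.trans hεsq
  have h := hlin n
  have hsmall : ∀ A : VField n, ‖A‖ ≤ a * ε → 4 * C * K * ‖A‖ ≤ 1 := fun A hA =>
    (mul_le_mul_of_nonneg_left hA (by positivity)).trans hsm
  have hbε : 6 * (a * ε) + 16 * ε₁ ≤ b * ε := by rw [hb]; linarith
  -- Here `ε₁ ≤ ε²` is essential: the term `2ε₁` has to be of second order.
  have hrem : ∀ A : VField n, ‖A‖ ≤ a * ε → ‖remainder V A‖ ≤ (a * b + 2) * ε ^ 2 := by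
    intro A hA
    refine (norm_remainder_le hε₁.le hV hs hA).trans ?_
    have := mul_le_mul_of_nonneg_right hbε hs0
    linarith
  have hT : ∀ A : VField n, ‖A‖ ≤ a * ε → ‖fixMap V A‖ ≤ N * ε ^ 2 := by
    intro A hA
    refine (h.norm_fixMap_le V (hA.trans hs) (hsmall A hA)).trans ?_
    rw [hN, mul_assoc _ (a * b + 2)]
    gcongr
    exact hrem A hA
  have hNa : N * ε ^ 2 ≤ a * ε := by
    have h1 := mul_le_mul_of_nonneg_right hNε hε.le
    have h2 := mul_le_mul_of_nonneg_right ha1 hε.le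
    linarith
  have hcontr : ∀ A A' : VField n, ‖A‖ ≤ a * ε → ‖A'‖ ≤ a * ε →
      ‖fixMap V A - fixMap V A'‖ ≤ 1 / 2 * ‖A - A'‖ := by
    intro A A' hA hA'
    have h1 : ‖remainder V A‖ ≤ (a * b + 2) * ε := by
      refine (hrem A hA).trans ?_
      gcongr
    have h2 : ‖remainder V A - remainder V A'‖ ≤ b * ε * ‖A - A'‖ :=
      (norm_remainder_sub_le hε₁.le hV hs hA hA').trans
        (mul_le_mul_of_nonneg_right hbε (norm_nonneg _))
    calc _ ≤ _ := h.norm_fixMap_sub_le V (hA.trans hs) (hsmall A hA) (hA'.trans hs)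
          (hsmall A' hA')
      _ ≤ (4 * K * C + (4 * K * C) ^ 2) * (4 * K) * ((a * b + 2) * ε) * ‖A - A'‖
          + (4 * K * C + 1) * (4 * K) * (b * ε * ‖A - A'‖) := by gcongr
      _ = N' * ε * ‖A - A'‖ := by rw [hN']; ring
      _ ≤ _ := by gcongr
  have h8 : 8 * (N * ε ^ 2) + ε₁ ≤ ε := by
    have := mul_le_mul_of_nonneg_right h9 hε.le
    linarith
  exact h.unique_solvability hε₁.le hV (by rw [ha]) hs0 hs hsm hNa h8 hT hcontr
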